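/- Let $M$ be a nonempty smooth $m$-dimensional manifold without boundary (Hausdorff and second countable, not necessarily connected), and let $F:M\to\mathbf{R}^n$ be a smooth proper immersion that is minimal, i.e., whose mean curvature vector vanishes identically. For $p\in\mathbf{R}^n$ and $r>0$ let \[ \Theta(M,p,r)=\frac{\operatorname{area}(M\cap\mathbf{B}(p,r))}{\omega_m r^m}, \] where $\operatorname{area}(M\cap \mathbf{B}(p,r))$ is the $m$-dimensional area of $F^{-1}(\mathbf{B}(p,r))$ in the metric on $M$ induced by $F$ (so that area is counted with multiplicity), $\mathbf{B}(p,r)$ is the ball of radius $r$ about $p$, and $\omega_m$ is the Lebesgue measure of the unit ball in $\mathbf{R}^m$. Then the limit \[ \Theta(M)=\lim_{r\to\infty}\Theta(M,p,r)\in[0,\infty] \] exists and is independent of $p\in\mathbf{R}^n$ (it is called the density of $M$ at infinity), and $\Theta(M)\ge 1$. Equality $\Theta(M)=1$ holds if and only if $M$ is a multiplicity-one plane, i.e., $F$ maps $M$ one-to-one onto an $m$-dimensional affine subspace of $\mathbf{R}^n$. -/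

import Mathlib

open Set Filter Topology MeasureTheory
open scoped Manifold ContDiff ENNReal

noncomputable section

namespace MinimalImmersion

variable {m n : ℕ}

/-- The `i`-th coordinate derivative at `u` of a map `φ` from (an open subset of) `ℝᵐ` to `ℝⁿ`. -/
def coordDeriv (φ : EuclideanSpace ℝ (Fin m) → EuclideanSpace ℝ (Fin n))
    (u : EuclideanSpace ℝ (Fin m)) (i : Fin m) : EuclideanSpace ℝ (Fin n) :=
  fderiv ℝ φ u (EuclideanSpace.single i 1)

/-- The second coordinate derivative `∂ᵢ∂ⱼφ` at `u`. -/
def coordDeriv₂ (φ : EuclideanSpace ℝ (Fin m) → EuclideanSpace ℝ (Fin n))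
    (u : EuclideanSpace ℝ (Fin m)) (i j : Fin m) : EuclideanSpace ℝ (Fin n) :=
  fderiv ℝ (fun v => coordDeriv φ v j) u (EuclideanSpace.single i 1)

/-- The first fundamental form `gᵢⱼ = ⟨∂ᵢφ, ∂ⱼφ⟩` of a parametrization `φ`. -/
def metricMatrix (φ : EuclideanSpace ℝ (Fin m) → EuclideanSpace ℝ (Fin n))
    (u : EuclideanSpace ℝ (Fin m)) : Matrix (Fin m) (Fin m) ℝ :=
  Matrix.gram ℝ (coordDeriv φ u)

/-- The tangent space of the parametrized submanifold: the span of the vectors `∂ᵢφ`. -/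
def tangentPlane (φ : EuclideanSpace ℝ (Fin m) → EuclideanSpace ℝ (Fin n))
    (u : EuclideanSpace ℝ (Fin m)) : Submodule ℝ (EuclideanSpace ℝ (Fin n)) :=
  Submodule.span ℝ (range (coordDeriv φ u))

/-- The mean curvature vector `∑ᵢⱼ gⁱʲ (∂ᵢ∂ⱼφ)ᴺ` of a parametrization `φ`, where `N` denotes the
normal component.  It equals `∑ₖ (∇_{eₖ} eₖ)ᴺ` for every orthonormal tangent frame `e`. -/
def paramMeanCurvature (φ : EuclideanSpace ℝ (Fin m) → EuclideanSpace ℝ (Fin n))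
    (u : EuclideanSpace ℝ (Fin m)) : EuclideanSpace ℝ (Fin n) :=
  ∑ i, ∑ j, (metricMatrix φ u)⁻¹ i j • (tangentPlane φ u)ᗮ.starProjection (coordDeriv₂ φ u i j)

/-- The Jacobian determinant `√(det (DφᵀDφ))`. -/
def areaJacobian (φ : EuclideanSpace ℝ (Fin m) → EuclideanSpace ℝ (Fin n))
    (u : EuclideanSpace ℝ (Fin m)) : ℝ :=
  √(metricMatrix φ u).det

variable {M : Type*} [TopologicalSpace M] [ChartedSpace (EuclideanSpace ℝ (Fin m)) M]

/-- The map `F` read in the preferred chart at `x`. -/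
def localParam (F : M → EuclideanSpace ℝ (Fin n)) (x : M) :
    EuclideanSpace ℝ (Fin m) → EuclideanSpace ℝ (Fin n) :=
  F ∘ (chartAt (EuclideanSpace ℝ (Fin m)) x).symm

/-- The mean curvature vector at `x ∈ M` of an immersion `F : M → ℝⁿ`.  It does not depend on the
chart at `x` in which it is computed. -/
def meanCurvature (m : ℕ) {n : ℕ} {M : Type*} [TopologicalSpace M]
    [ChartedSpace (EuclideanSpace ℝ (Fin m)) M]
    (F : M → EuclideanSpace ℝ (Fin n)) (x : M) : EuclideanSpace ℝ (Fin n) :=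
  paramMeanCurvature (localParam (m := m) F x) (chartAt (EuclideanSpace ℝ (Fin m)) x x)

/-- `M`, with the map `F : M → ℝⁿ`, is a properly immersed minimal `m`-dimensional submanifold
without boundary: `F` is a smooth proper immersion whose mean curvature vanishes everywhere. -/
structure IsProperMinimalImmersion (m : ℕ) {n : ℕ} {M : Type*} [TopologicalSpace M]
    [ChartedSpace (EuclideanSpace ℝ (Fin m)) M] (F : M → EuclideanSpace ℝ (Fin n)) : Prop where
  contMDiff : ContMDiff (𝓡 m) (𝓡 n) ∞ F
  immersion : ∀ x, Function.Injective (mfderiv (𝓡 m) (𝓡 n) F x)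
  proper : IsProperMap F
  minimal : ∀ x, meanCurvature m F x = 0

variable [MeasurableSpace M]

/-- The `m`-dimensional area on the domain of the preferred chart at `x`, in the metric induced by
`F`: the area of `A` is the integral of the Jacobian over the part of the chart's target that the
inverse chart maps into `A`. -/
def chartArea (F : M → EuclideanSpace ℝ (Fin n)) (x : M) : Measure M :=
  (((volume : Measure (EuclideanSpace ℝ (Fin m))).restrict
      (chartAt (EuclideanSpace ℝ (Fin m)) x).target).withDensity
        (fun u => ENNReal.ofReal (areaJacobian (localParam F x) u))).map
    (chartAt (EuclideanSpace ℝ (Fin m)) x).symm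

/-- The `m`-dimensional area measure on `M` of the metric induced by `F` (so that images are counted
with multiplicity).  By the change of variables formula the measures `chartArea F x` agree on the
overlaps of the charts; the area measure is the one of which they are the restrictions to the
chart domains, and this is their supremum in the complete lattice of measures, as countably many
of the chart domains cover `M`. -/
def areaMeasure (m : ℕ) {n : ℕ} {M : Type*} [TopologicalSpace M]
    [ChartedSpace (EuclideanSpace ℝ (Fin m)) M] [MeasurableSpace M]
    (F : M → EuclideanSpace ℝ (Fin n)) : Measure M :=
  ⨆ x : M, chartArea (m := m) F x

/-- The density ratio `Θ(M, p, r) = area(M ∩ B(p, r)) / (ω_m r^m)`. -/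
def densityRatio (m : ℕ) {n : ℕ} {M : Type*} [TopologicalSpace M]
    [ChartedSpace (EuclideanSpace ℝ (Fin m)) M] [MeasurableSpace M]
    (F : M → EuclideanSpace ℝ (Fin n)) (p : EuclideanSpace ℝ (Fin n)) (r : ℝ) : ℝ≥0∞ :=
  areaMeasure m F (F ⁻¹' Metric.ball p r) /
    (volume (Metric.ball (0 : EuclideanSpace ℝ (Fin m)) 1) * ENNReal.ofReal (r ^ m))

/-- `Θ` is the density at infinity: for every centre `p`, the density ratios `Θ(M, p, r)` converge
to `Θ` (in `[0, ∞]`) as `r → ∞`. -/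
def HasDensityAtInfinity (m : ℕ) {n : ℕ} {M : Type*} [TopologicalSpace M]
    [ChartedSpace (EuclideanSpace ℝ (Fin m)) M] [MeasurableSpace M]
    (F : M → EuclideanSpace ℝ (Fin n)) (Θ : ℝ≥0∞) : Prop :=
  ∀ p, Tendsto (fun r : ℝ => densityRatio m F p r) atTop (𝓝 Θ)

/-- The immersed manifold is a plane with multiplicity one: `F` maps `M` one-to-one onto an
`m`-dimensional affine subspace of `ℝⁿ`. -/
def IsMultiplicityOnePlane (m : ℕ) {n : ℕ} {M : Type*} (F : M → EuclideanSpace ℝ (Fin n)) : Prop :=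
  ∃ P : AffineSubspace ℝ (EuclideanSpace ℝ (Fin n)),
    (P : Set (EuclideanSpace ℝ (Fin n))).Nonempty ∧ Module.finrank ℝ P.direction = m ∧
      BijOn F univ P

end MinimalImmersion

end

open Set Filter Topology MeasureTheory
open scoped Manifold ContDiff ENNReal

set_option linter.unusedSectionVars false

/-! The engine is the monotonicity formula. In a parametrization `φ` with metric `g`, the fields
`W_i = √g ∑ⱼ gⁱʲ ∂ⱼφ` have divergence `∑ᵢ ∂ᵢW_i` equal to `√g` times the mean curvature vector. For
a minimal immersion this vanishes, so integration by parts and a partition of unity give the first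
variation formula `∫ div_M Y = 0` for every compactly supported `C¹` field `Y` along `F`
(`integral_tangentialDiv`).

Take `Y = χ(t²|F - p|²)(F - p)` with `χ` a cutoff; properness of `F` makes its support compact. Its
divergence is `mχ + 2t²χ'|(F - p)ᵀ|²`. Replacing `|(F - p)ᵀ|²` by `|F - p|²` would produce, up to a
positive factor, the derivative of `t ↦ tᵐ ∫ χ(t²|F - p|²)`. That derivative is therefore minus the
integral of a nonnegative defect, proportional to `χ'·(|(F - p)ᵀ|² - |F - p|²)`. Letting `χ`
increase to the indicator of `[0, 1)`, with `r = 1/t`, shows that area divided by `rᵐ` is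
nondecreasing in `r` (`monotoneOn_area_div_pow`). The limit at infinity is thus a supremum, and
`B(p, r) ⊆ B(q, r + |p - q|)` makes it independent of the centre.

Near a point `x` the immersion is close to its differential, so the ratios about `F x` are at small
radii at least any number below `1` (`eventually_le_area`). By monotonicity they are at least `1` at
every radius, hence `Θ ≥ 1`.

If `Θ = 1`, all ratios centred at points of `F(M)` equal `1`, so the defect vanishes: `F x - F z` is
tangent at `x` for all `x` and `z`. Fixing `x` puts `F(M)` in one `m`-plane. Projected to it, `F` is
open, being a local diffeomorphism, and has closed image by properness, hence is onto. It is
injective because two sheets through one point would give ratios above `1`. Conversely, for an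
injective immersion into an `m`-plane the area of a piece is the Lebesgue measure of its image, so
the ratios about points of the plane are at most `1`. -/

namespace MinimalImmersion

variable {m n : ℕ}
local notation "𝔼" k:max => EuclideanSpace ℝ (Fin k)
open scoped RealInnerProductSpace

/-! ### Linear algebra: Gram matrices, tangential trace and tangential projection -/

/-- The Gram matrix of the images of the standard basis vectors under a linear map `A`. -/
noncomputable def gramMatrix (A : 𝔼 m →L[ℝ] 𝔼 n) : Matrix (Fin m) (Fin m) ℝ :=
  Matrix.gram ℝ (fun i => A (EuclideanSpace.single i 1))

/-- The matrix of an endomorphism of `ℝᵐ`. -/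
noncomputable def coordMatrix (S : 𝔼 m →L[ℝ] 𝔼 m) : Matrix (Fin m) (Fin m) ℝ :=
  Matrix.of fun k j => S (EuclideanSpace.single j 1) k

theorem sum_smul_single (v : 𝔼 m) : ∑ i, v i • (EuclideanSpace.single i 1 : 𝔼 m) = v := by
  simpa using (EuclideanSpace.basisFun (Fin m) ℝ).sum_repr v

theorem apply_eq_sum {G : Type*} [NormedAddCommGroup G] [NormedSpace ℝ G] (A : 𝔼 m →L[ℝ] G) (v : 𝔼 m) :
    A v = ∑ i, v i • A (EuclideanSpace.single i 1) := by
  conv_lhs => rw [← sum_smul_single v]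
  simp

theorem det_coordMatrix (S : 𝔼 m →L[ℝ] 𝔼 m) : (coordMatrix S).det = S.det := by
  have h : coordMatrix S = LinearMap.toMatrix (EuclideanSpace.basisFun (Fin m) ℝ).toBasis
      (EuclideanSpace.basisFun (Fin m) ℝ).toBasis (S : 𝔼 m →ₗ[ℝ] 𝔼 m) := by
    ext i j
    simp [coordMatrix, LinearMap.toMatrix_apply]
  rw [h, LinearMap.det_toMatrix]

theorem gramMatrix_comp (A : 𝔼 m →L[ℝ] 𝔼 n) (S : 𝔼 m →L[ℝ] 𝔼 m) :
    gramMatrix (A.comp S) = (coordMatrix S).transpose * gramMatrix A * coordMatrix S := by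
  ext i j
  simp only [gramMatrix, Matrix.gram_apply, ContinuousLinearMap.comp_apply]
  rw [apply_eq_sum A (S (EuclideanSpace.single i 1)), apply_eq_sum A (S (EuclideanSpace.single j 1))]
  simp only [Matrix.mul_apply, Matrix.transpose_apply, coordMatrix, Matrix.of_apply, Matrix.gram_apply,
    sum_inner, inner_sum, inner_smul_left, inner_smul_right, Finset.sum_mul, Finset.mul_sum]
  refine Finset.sum_congr rfl fun k _ => Finset.sum_congr rfl fun l _ => ?_
  simp [real_inner_comm]; ring

theorem linearIndependent_of_injective {A : 𝔼 m →L[ℝ] 𝔼 n} (hA : Function.Injective A) :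
    LinearIndependent ℝ (fun i => A (EuclideanSpace.single i 1)) := by
  have h := (EuclideanSpace.basisFun (Fin m) ℝ).toBasis.linearIndependent
  have := h.map' (A : 𝔼 m →ₗ[ℝ] 𝔼 n) (LinearMap.ker_eq_bot.2 hA)
  have he : (fun i => A (EuclideanSpace.single i 1)) =
      (A : 𝔼 m →ₗ[ℝ] 𝔼 n) ∘ (EuclideanSpace.basisFun (Fin m) ℝ).toBasis := by
    ext1 i; simp
  rwa [he]

theorem gramMatrix_posDef {A : 𝔼 m →L[ℝ] 𝔼 n} (hA : Function.Injective A) : (gramMatrix A).PosDef :=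
  Matrix.posDef_gram_of_linearIndependent (linearIndependent_of_injective hA)

theorem gramMatrix_det_pos {A : 𝔼 m →L[ℝ] 𝔼 n} (hA : Function.Injective A) :
    0 < (gramMatrix A).det := (gramMatrix_posDef hA).det_pos

theorem gramMatrix_isSymm (A : 𝔼 m →L[ℝ] 𝔼 n) : (gramMatrix A).transpose = gramMatrix A := by
  ext i j; simp [gramMatrix, Matrix.gram_apply, real_inner_comm]

/-- The trace of `B` along the range of `A`: if `A` is the derivative of an immersion and `B` that of
a vector field along it, this is the tangential divergence of the field. -/
noncomputable def tangentialTrace (A B : 𝔼 m →L[ℝ] 𝔼 n) : ℝ :=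
  ∑ i, ∑ j, (gramMatrix A)⁻¹ i j * ⟪B (EuclideanSpace.single i 1), A (EuclideanSpace.single j 1)⟫

theorem tangentialTrace_eq_trace (A B : 𝔼 m →L[ℝ] 𝔼 n) :
    tangentialTrace A B = ((gramMatrix A)⁻¹ *
      (Matrix.of fun j i => ⟪B (EuclideanSpace.single i 1), A (EuclideanSpace.single j 1)⟫)).trace := by
  simp [tangentialTrace, Matrix.trace, Matrix.mul_apply]

theorem isUnit_coordMatrix {S : 𝔼 m →L[ℝ] 𝔼 m} (hS : S.det ≠ 0) : IsUnit (coordMatrix S).det := by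
  rw [det_coordMatrix]; exact hS.isUnit

/-- Reparametrizing turns the inverse Gram matrix into `S⁻¹g⁻¹S⁻ᵀ` and the matrix of inner products
into `Sᵀ(·)S`; the factors cancel under the trace. This makes the tangential divergence independent
of the chart. -/
theorem tangentialTrace_comp (A B : 𝔼 m →L[ℝ] 𝔼 n) {S : 𝔼 m →L[ℝ] 𝔼 m} (hS : S.det ≠ 0) :
    tangentialTrace (A.comp S) (B.comp S) = tangentialTrace A B := by
  have hS' := isUnit_coordMatrix hS
  rw [tangentialTrace_eq_trace, tangentialTrace_eq_trace, gramMatrix_comp]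
  have h : (Matrix.of fun j i => ⟪(B.comp S) (EuclideanSpace.single i 1),
      (A.comp S) (EuclideanSpace.single j 1)⟫) = (coordMatrix S).transpose *
      (Matrix.of fun j i => ⟪B (EuclideanSpace.single i 1), A (EuclideanSpace.single j 1)⟫) *
      coordMatrix S := by
    ext i j
    simp only [ContinuousLinearMap.comp_apply, Matrix.of_apply]
    rw [apply_eq_sum A (S (EuclideanSpace.single i 1)),
      apply_eq_sum B (S (EuclideanSpace.single j 1))]
    simp only [Matrix.mul_apply, Matrix.transpose_apply, coordMatrix, Matrix.of_apply,
      sum_inner, inner_sum, inner_smul_left, inner_smul_right, Finset.sum_mul, Finset.mul_sum]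
    rw [Finset.sum_comm]
    refine Finset.sum_congr rfl fun k _ => Finset.sum_congr rfl fun l _ => ?_
    simp; ring
  rw [h]
  set P := coordMatrix S
  rw [Matrix.mul_inv_rev, Matrix.mul_inv_rev]
  have hPT : IsUnit P.transpose.det := by simpa using hS'
  rw [Matrix.trace_mul_comm]
  simp only [Matrix.mul_assoc]
  rw [Matrix.mul_nonsing_inv_cancel_left _ _ hS', Matrix.trace_mul_comm]
  simp only [Matrix.mul_assoc]
  rw [Matrix.nonsing_inv_mul _ hPT, Matrix.mul_one, Matrix.trace_mul_comm]

theorem tangentialTrace_add (A B C : 𝔼 m →L[ℝ] 𝔼 n) :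
    tangentialTrace A (B + C) = tangentialTrace A B + tangentialTrace A C := by
  simp [tangentialTrace, inner_add_left, mul_add, Finset.sum_add_distrib]

theorem tangentialTrace_zero (A : 𝔼 m →L[ℝ] 𝔼 n) : tangentialTrace A 0 = 0 := by
  simp [tangentialTrace]

/-- The squared norm of the orthogonal projection of `w` to the range of `A`. -/
noncomputable def tangentialSq (A : 𝔼 m →L[ℝ] 𝔼 n) (w : 𝔼 n) : ℝ :=
  ∑ i, ∑ j, (gramMatrix A)⁻¹ i j *
    (⟪w, A (EuclideanSpace.single i 1)⟫ * ⟪w, A (EuclideanSpace.single j 1)⟫)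

theorem norm_sub_sq_eq_sub_tangentialSq {A : 𝔼 m →L[ℝ] 𝔼 n} (hA : Function.Injective A) (w : 𝔼 n) :
    ∃ v, ‖w - A v‖ ^ 2 = ‖w‖ ^ 2 - tangentialSq A w := by
  set g := gramMatrix A with hg
  have hu : IsUnit g.det := (gramMatrix_det_pos hA).ne'.isUnit
  let b : Fin m → ℝ := fun i => ⟪w, A (EuclideanSpace.single i 1)⟫
  -- `a` solves the normal equations `g a = b`, so `A v` is the orthogonal projection of `w` to the
  -- range of `A`.
  let a : Fin m → ℝ := g⁻¹.mulVec b
  let v : 𝔼 m := WithLp.toLp 2 a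
  have hv : A v = ∑ i, a i • A (EuclideanSpace.single i 1) := apply_eq_sum A v
  have h1 : ⟪w, A v⟫ = tangentialSq A w := by
    rw [hv, inner_sum]
    simp only [inner_smul_right, tangentialSq, a, Matrix.mulVec, dotProduct, Finset.sum_mul]
    exact Finset.sum_congr rfl fun i _ => Finset.sum_congr rfl fun j _ => by simp only [b]; ring
  have h2 : ⟪A v, A v⟫ = ⟪w, A v⟫ := by
    conv_lhs => rw [hv]
    rw [sum_inner]
    conv_rhs => rw [hv]
    rw [inner_sum]
    refine Finset.sum_congr rfl fun i _ => ?_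
    rw [inner_smul_left, inner_smul_right, inner_sum]
    have : g.mulVec a = b := by
      simp only [a]; rw [Matrix.mulVec_mulVec, Matrix.mul_nonsing_inv _ hu, Matrix.one_mulVec]
    have hi := congrFun this i
    simp only [Matrix.mulVec, dotProduct] at hi
    simp only [inner_smul_right]
    rw [show ⟪w, A (EuclideanSpace.single i 1)⟫ = b i from rfl, ← hi]
    simp [hg, gramMatrix, Matrix.gram_apply, mul_comm]
  refine ⟨v, ?_⟩
  rw [norm_sub_sq_real, h1, ← real_inner_self_eq_norm_sq (A v), h2, h1]
  ring

theorem tangentialSq_le {A : 𝔼 m →L[ℝ] 𝔼 n} (hA : Function.Injective A) (w : 𝔼 n) :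
    tangentialSq A w ≤ ‖w‖ ^ 2 := by
  obtain ⟨v, hv⟩ := norm_sub_sq_eq_sub_tangentialSq hA w
  nlinarith [sq_nonneg ‖w - A v‖]

theorem mem_range_of_tangentialSq_eq {A : 𝔼 m →L[ℝ] 𝔼 n} (hA : Function.Injective A) {w : 𝔼 n}
    (h : tangentialSq A w = ‖w‖ ^ 2) : ∃ v, A v = w := by
  obtain ⟨v, hv⟩ := norm_sub_sq_eq_sub_tangentialSq hA w
  refine ⟨v, ?_⟩
  rw [h, sub_self] at hv
  exact (sub_eq_zero.1 (norm_eq_zero.1 (pow_eq_zero_iff (two_ne_zero) |>.1 hv))).symm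

/-- With `w = F - p`, this is the shape of the derivative of a radial field `χ·(F - p)`: `a` is the
value of the cutoff, and `b` comes from its derivative. -/
theorem tangentialTrace_radial {A : 𝔼 m →L[ℝ] 𝔼 n} (hA : Function.Injective A) (a b : ℝ) (w : 𝔼 n) :
    tangentialTrace A (a • A + b • ((innerSL ℝ w).comp A).smulRight w) =
      a * m + b * tangentialSq A w := by
  have hu : IsUnit (gramMatrix A).det := (gramMatrix_det_pos hA).ne'.isUnit
  have h1 : (m : ℝ) = ∑ i, ∑ j, (gramMatrix A)⁻¹ i j *
      ⟪A (EuclideanSpace.single i 1), A (EuclideanSpace.single j 1)⟫ := by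
    have : ((gramMatrix A)⁻¹ * (gramMatrix A).transpose).trace = m := by
      rw [gramMatrix_isSymm, Matrix.nonsing_inv_mul _ hu]; simp
    rw [← this]
    simp [Matrix.trace, Matrix.mul_apply, gramMatrix, Matrix.gram_apply]
  rw [h1]
  simp only [tangentialTrace, tangentialSq, Finset.mul_sum, ← Finset.sum_add_distrib]
  refine Finset.sum_congr rfl fun i _ => Finset.sum_congr rfl fun j _ => ?_
  simp [inner_add_left, inner_smul_left]
  ring

theorem exists_isometry_comp {A : 𝔼 m →L[ℝ] 𝔼 n} (hA : Function.Injective A) :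
    ∃ (J : 𝔼 m →ₗᵢ[ℝ] 𝔼 n) (B : 𝔼 m →L[ℝ] 𝔼 m), A = J.toContinuousLinearMap.comp B := by
  have hr : Module.finrank ℝ (A : 𝔼 m →ₗ[ℝ] 𝔼 n).range = m := by
    rw [LinearMap.finrank_range_of_inj hA]; simp
  let ι := (stdOrthonormalBasis ℝ (A : 𝔼 m →ₗ[ℝ] 𝔼 n).range).reindex (finCongr hr) |>.repr
  let J : 𝔼 m →ₗᵢ[ℝ] 𝔼 n := (Submodule.subtypeₗᵢ _).comp ι.symm.toLinearIsometry
  refine ⟨J, (ι.toContinuousLinearEquiv : _ →L[ℝ] 𝔼 m).comp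
    (A.codRestrict (A : 𝔼 m →ₗ[ℝ] 𝔼 n).range fun x => ⟨x, rfl⟩), ?_⟩
  ext1 v
  change A v = ((ι.symm (ι ⟨A v, v, rfl⟩) : (A : 𝔼 m →ₗ[ℝ] 𝔼 n).range) : 𝔼 n)
  rw [LinearIsometryEquiv.symm_apply_apply]

theorem sqrt_det_gramMatrix_isometry_comp (J : 𝔼 m →ₗᵢ[ℝ] 𝔼 n) (B : 𝔼 m →L[ℝ] 𝔼 m) :
    √(gramMatrix (J.toContinuousLinearMap.comp B)).det = |B.det| := by
  have : gramMatrix J.toContinuousLinearMap = 1 := by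
    refine (Matrix.gram_eq_one_iff_orthonormal).2 ?_
    have := ((EuclideanSpace.basisFun (Fin m) ℝ).orthonormal).comp_linearIsometry J
    have he : (fun i => J.toContinuousLinearMap (EuclideanSpace.single i 1)) =
        J ∘ EuclideanSpace.basisFun (Fin m) ℝ := by
      ext1 i; simp
    rwa [he]
  rw [gramMatrix_comp, this, Matrix.mul_one, Matrix.det_mul, Matrix.det_transpose, det_coordMatrix,
    Real.sqrt_mul_self_eq_abs]

theorem sqrt_det_gramMatrix_comp (A : 𝔼 m →L[ℝ] 𝔼 n) (S : 𝔼 m →L[ℝ] 𝔼 m) :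
    √(gramMatrix (A.comp S)).det = |S.det| * √(gramMatrix A).det := by
  rw [gramMatrix_comp, Matrix.det_mul, Matrix.det_mul, Matrix.det_transpose, det_coordMatrix,
    show S.det * (gramMatrix A).det * S.det = S.det ^ 2 * (gramMatrix A).det by ring,
    Real.sqrt_mul (sq_nonneg _), Real.sqrt_sq_eq_abs]

/-- Writing `A` as an isometry after an endomorphism `B`, the Jacobian is `|det B|` and the
ellipsoid is the preimage under `B` of a round ball, so the two determinants cancel. This is the
density of a plane, used to compare an immersion with its tangent plane. -/
theorem sqrt_det_gramMatrix_mul_volume {A : 𝔼 m →L[ℝ] 𝔼 n} (hA : Function.Injective A) {r : ℝ} (hr : 0 < r) :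
    ENNReal.ofReal (√(gramMatrix A).det) * volume {w | ‖A w‖ < r} =
      volume (Metric.ball (0 : 𝔼 m) 1) * ENNReal.ofReal (r ^ m) := by
  obtain ⟨J, B, rfl⟩ := exists_isometry_comp hA
  have hpos := gramMatrix_det_pos hA
  have hsq := Real.sqrt_pos.2 hpos
  rw [sqrt_det_gramMatrix_isometry_comp] at *
  have hB : LinearMap.det (B : 𝔼 m →ₗ[ℝ] 𝔼 m) ≠ 0 := abs_pos.1 hsq
  have h : {w | ‖J.toContinuousLinearMap.comp B w‖ < r} =
      (B : 𝔼 m →ₗ[ℝ] 𝔼 m) ⁻¹' Metric.ball 0 r := by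
    ext w; simp
  rw [h, Measure.addHaar_preimage_linearMap _ hB, ← mul_assoc, ← ENNReal.ofReal_mul (abs_nonneg _),
    abs_inv]
  have : |B.det| * |LinearMap.det (B : 𝔼 m →ₗ[ℝ] 𝔼 m)|⁻¹ = 1 := mul_inv_cancel₀ hsq.ne'
  rw [this, ENNReal.ofReal_one, one_mul, Measure.addHaar_ball_of_pos _ _ hr, mul_comm]
  simp

/-! ### Calculus: Jacobi's formula, smoothness of inverse matrices, integrals of derivatives -/

/-- Both sides are sums of determinants in which one column is differentiated: on the right by
Cramer's rule, on the left by the product rule in the Leibniz expansion. -/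
theorem hasDerivAt_det {k : ℕ} {G : ℝ → Matrix (Fin k) (Fin k) ℝ} {G' : Matrix (Fin k) (Fin k) ℝ}
    {t : ℝ} (h : ∀ i j, HasDerivAt (fun s => G s i j) (G' i j) t) :
    HasDerivAt (fun s => (G s).det) ((G t).adjugate * G').trace t := by
  have h1 : ((G t).adjugate * G').trace = ∑ i, ((G t).updateCol i fun k => G' k i).det := by
    simp only [Matrix.trace, Matrix.diag]
    refine Finset.sum_congr rfl fun i _ => ?_
    rw [← Matrix.cramer_apply, Matrix.cramer_eq_adjugate_mulVec]
    rfl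
  rw [h1]
  simp only [Matrix.det_apply]
  rw [Finset.sum_comm]
  refine HasDerivAt.fun_sum fun σ _ => ?_
  rw [← Finset.smul_sum]
  refine HasDerivAt.const_smul (Equiv.Perm.sign σ) ?_
  refine (HasDerivAt.fun_finsetProd fun i (_ : i ∈ Finset.univ) => h (σ i) i).congr_deriv ?_
  refine Finset.sum_congr rfl fun i _ => ?_
  rw [← Finset.mul_prod_erase _ _ (Finset.mem_univ i), smul_eq_mul, mul_comm]
  congr 1
  · simp
  · exact Finset.prod_congr rfl fun j hj => by simp [Finset.ne_of_mem_erase hj]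

theorem contDiffAt_det {X : Type*} [NormedAddCommGroup X] [NormedSpace ℝ X] {k : ℕ} {r : WithTop ℕ∞}
    {G : X → Matrix (Fin k) (Fin k) ℝ} {u : X} (h : ∀ i j, ContDiffAt ℝ r (fun v => G v i j) u) :
    ContDiffAt ℝ r (fun v => (G v).det) u := by
  simp only [Matrix.det_apply]
  refine ContDiffAt.sum fun σ _ => ContDiffAt.const_smul _ ?_
  exact contDiffAt_prod fun i _ => h _ _

theorem contDiffAt_inv_apply {X : Type*} [NormedAddCommGroup X] [NormedSpace ℝ X] {k : ℕ}
    {r : WithTop ℕ∞} {G : X → Matrix (Fin k) (Fin k) ℝ} {u : X}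
    (h : ∀ i j, ContDiffAt ℝ r (fun v => G v i j) u) (hu : (G u).det ≠ 0) (i j : Fin k) :
    ContDiffAt ℝ r (fun v => (G v)⁻¹ i j) u := by
  have : (fun v => (G v)⁻¹ i j) = fun v => (G v).det⁻¹ * ((G v).updateRow j (Pi.single i 1)).det := by
    ext v
    rw [Matrix.inv_def, Matrix.smul_apply, Matrix.adjugate_apply, Ring.inverse_eq_inv', smul_eq_mul]
  rw [this]
  refine ((contDiffAt_det h).inv hu).mul (contDiffAt_det fun a b => ?_)
  by_cases hb : a = j
  · subst hb; simpa using contDiffAt_const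
  · simpa [Matrix.updateRow_ne hb] using h a b

theorem integral_fderiv_eq_zero {f : 𝔼 m → ℝ} (hf : ContDiff ℝ 1 f) (hc : HasCompactSupport f) (v : 𝔼 m) :
    ∫ u, fderiv ℝ f u v = 0 := by
  have hc' : HasCompactSupport fun u => fderiv ℝ f u v := hc.fderiv_apply (𝕜 := ℝ) v
  have hi : Integrable (fun u => fderiv ℝ f u v) :=
    ((hf.continuous_fderiv one_ne_zero).clm_apply continuous_const).integrable_of_hasCompactSupport hc'
  have := integral_mul_fderiv_eq_neg_fderiv_mul_of_integrable (μ := (volume : Measure (𝔼 m)))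
    (f := fun _ => (1 : ℝ)) (g := f) (v := v) (by simp) (by simpa using hi)
    (by simpa using hf.continuous.integrable_of_hasCompactSupport hc)
    (fun x _ => by fun_prop) (fun x _ => hf.differentiable one_ne_zero x)
  simpa using this

/-! ### The first variation in a parametrization -/

/-- The Laplace–Beltrami coefficients of a parametrization: the fields
`√g ∑ⱼ gⁱʲ ∂ⱼφ`. -/
noncomputable def conormalField (φ : 𝔼 m → 𝔼 n) (i : Fin m) (u : 𝔼 m) : 𝔼 n :=
  ∑ j, (areaJacobian φ u * (metricMatrix φ u)⁻¹ i j) • coordDeriv φ u j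

section Param

variable {φ : 𝔼 m → 𝔼 n} {u : 𝔼 m}

theorem contDiffAt_coordDeriv (hφ : ContDiffAt ℝ ∞ φ u) (i : Fin m) :
    ContDiffAt ℝ ∞ (fun v => coordDeriv φ v i) u :=
  (hφ.fderiv_right (m := ∞) (by simp)).clm_apply contDiffAt_const

theorem contDiffAt_metricMatrix (hφ : ContDiffAt ℝ ∞ φ u) (i j : Fin m) :
    ContDiffAt ℝ ∞ (fun v => metricMatrix φ v i j) u := by
  simp only [metricMatrix, Matrix.gram_apply]
  exact (contDiffAt_coordDeriv hφ i).inner ℝ (contDiffAt_coordDeriv hφ j)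

theorem metricMatrix_eq (φ : 𝔼 m → 𝔼 n) (u : 𝔼 m) : metricMatrix φ u = gramMatrix (fderiv ℝ φ u) := rfl

theorem areaJacobian_eq (φ : 𝔼 m → 𝔼 n) (u : 𝔼 m) :
    areaJacobian φ u = √(gramMatrix (fderiv ℝ φ u)).det := rfl

theorem areaJacobian_nonneg (φ : 𝔼 m → 𝔼 n) (u : 𝔼 m) : 0 ≤ areaJacobian φ u := Real.sqrt_nonneg _

theorem metricMatrix_det_pos (hi : Function.Injective (fderiv ℝ φ u)) : 0 < (metricMatrix φ u).det :=
  gramMatrix_det_pos hi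

theorem areaJacobian_pos (hi : Function.Injective (fderiv ℝ φ u)) : 0 < areaJacobian φ u :=
  Real.sqrt_pos.2 (gramMatrix_det_pos hi)

theorem contDiffAt_areaJacobian (hφ : ContDiffAt ℝ ∞ φ u) (hi : Function.Injective (fderiv ℝ φ u)) :
    ContDiffAt ℝ ∞ (areaJacobian φ) u :=
  (contDiffAt_det (contDiffAt_metricMatrix hφ)).sqrt (gramMatrix_det_pos hi).ne'

theorem contDiffAt_coeff (hφ : ContDiffAt ℝ ∞ φ u) (hi : Function.Injective (fderiv ℝ φ u)) (i j : Fin m) :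
    ContDiffAt ℝ ∞ (fun v => areaJacobian φ v * (metricMatrix φ v)⁻¹ i j) u :=
  (contDiffAt_areaJacobian hφ hi).mul
    (contDiffAt_inv_apply (contDiffAt_metricMatrix hφ) (gramMatrix_det_pos hi).ne' i j)

theorem contDiffAt_conormalField (hφ : ContDiffAt ℝ ∞ φ u) (hi : Function.Injective (fderiv ℝ φ u))
    (i : Fin m) : ContDiffAt ℝ ∞ (conormalField φ i) u :=
  ContDiffAt.sum fun j _ => (contDiffAt_coeff hφ hi i j).smul (contDiffAt_coordDeriv hφ j)

theorem coordDeriv₂_eq (hφ : ContDiffAt ℝ ∞ φ u) (i j : Fin m) : coordDeriv₂ φ u i j =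
    fderiv ℝ (fderiv ℝ φ) u (EuclideanSpace.single i 1) (EuclideanSpace.single j 1) := by
  have h : DifferentiableAt ℝ (fderiv ℝ φ) u :=
    (hφ.fderiv_right (m := ∞) (by simp)).differentiableAt (by simp)
  simp only [coordDeriv₂, coordDeriv]
  rw [fderiv_clm_apply h (by fun_prop)]
  simp

theorem coordDeriv₂_comm (hφ : ContDiffAt ℝ ∞ φ u) (i j : Fin m) :
    coordDeriv₂ φ u i j = coordDeriv₂ φ u j i := by
  rw [coordDeriv₂_eq hφ, coordDeriv₂_eq hφ]
  refine (hφ.isSymmSndFDerivAt ?_) _ _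
  rw [minSmoothness_of_isRCLikeNormedField]
  exact WithTop.coe_le_coe.2 le_top

theorem inner_conormalField (hi : Function.Injective (fderiv ℝ φ u)) (i k : Fin m) :
    ⟪conormalField φ i u, coordDeriv φ u k⟫ = if i = k then areaJacobian φ u else 0 := by
  have h : ((metricMatrix φ u)⁻¹ * metricMatrix φ u) i k = if i = k then 1 else 0 := by
    rw [Matrix.nonsing_inv_mul _ (metricMatrix_det_pos hi).ne'.isUnit, Matrix.one_apply]
  simp only [conormalField, sum_inner, inner_smul_left]
  have h2 : ∑ j, (starRingEnd ℝ) (areaJacobian φ u * (metricMatrix φ u)⁻¹ i j) *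
      ⟪coordDeriv φ u j, coordDeriv φ u k⟫ =
      areaJacobian φ u * ((metricMatrix φ u)⁻¹ * metricMatrix φ u) i k := by
    simp only [Matrix.mul_apply, Finset.mul_sum]
    refine Finset.sum_congr rfl fun j _ => ?_
    simp [metricMatrix, Matrix.gram_apply]; ring
  rw [h2, h]; split_ifs <;> simp

/-- Jacobi's formula gives `∂ₖ√g = ½ √g tr(g⁻¹ ∂ₖg)`, and the symmetry of `g⁻¹` merges the two terms
of `∂ₖgᵢⱼ`. -/
theorem fderiv_areaJacobian (hφ : ContDiffAt ℝ ∞ φ u) (hi : Function.Injective (fderiv ℝ φ u)) (k : Fin m) :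
    fderiv ℝ (areaJacobian φ) u (EuclideanSpace.single k 1) =
      ∑ i, ⟪conormalField φ i u, coordDeriv₂ φ u k i⟫ := by
  have hpos := metricMatrix_det_pos hi
  set e : 𝔼 m := EuclideanSpace.single k 1
  have hd : ∀ i, DifferentiableAt ℝ (fun v => coordDeriv φ v i) u := fun i =>
    (contDiffAt_coordDeriv hφ i).differentiableAt (by simp)
  let G' : Matrix (Fin m) (Fin m) ℝ := Matrix.of fun i j =>
    ⟪coordDeriv φ u i, coordDeriv₂ φ u k j⟫ + ⟪coordDeriv₂ φ u k i, coordDeriv φ u j⟫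
  have h1 : ∀ i j, HasDerivAt (fun t : ℝ => metricMatrix φ (u + t • e) i j) (G' i j) 0 := fun i j =>
    (((hd i).hasFDerivAt.inner ℝ (hd j).hasFDerivAt).hasLineDerivAt e).congr_deriv (by
      simp [G', coordDeriv₂, e, fderivInnerCLM_apply])
  have h2 := hasDerivAt_det h1
  have h3 := h2.sqrt (by simpa using hpos.ne')
  have h4 := ((contDiffAt_areaJacobian hφ hi).differentiableAt (by simp)).hasFDerivAt.hasLineDerivAt e
  have h5 := h4.unique h3
  rw [h5]
  simp only [zero_smul, add_zero]
  change _ / (2 * areaJacobian φ u) = _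
  have hJ := areaJacobian_pos hi
  have hadj : (metricMatrix φ u).adjugate = (areaJacobian φ u) ^ 2 • (metricMatrix φ u)⁻¹ := by
    rw [areaJacobian, Real.sq_sqrt hpos.le, Matrix.inv_def, smul_smul, Ring.mul_inverse_cancel _ hpos.ne'.isUnit,
      one_smul]
  rw [hadj, Matrix.smul_mul, Matrix.trace_smul, smul_eq_mul, div_eq_iff (by positivity)]
  have hsymm : ∀ i j, (metricMatrix φ u)⁻¹ i j = (metricMatrix φ u)⁻¹ j i := fun i j => by
    conv_lhs => rw [metricMatrix_eq, ← gramMatrix_isSymm, ← Matrix.transpose_nonsing_inv]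
    rfl
  have key : ((metricMatrix φ u)⁻¹ * G').trace =
      2 * ∑ i, ∑ j, (metricMatrix φ u)⁻¹ i j * ⟪coordDeriv φ u j, coordDeriv₂ φ u k i⟫ := by
    simp only [Matrix.trace, Matrix.diag, Matrix.mul_apply, G', Matrix.of_apply, mul_add,
      Finset.sum_add_distrib, two_mul]
    congr 1
    rw [Finset.sum_comm]
    refine Finset.sum_congr rfl fun i _ => Finset.sum_congr rfl fun j _ => ?_
    rw [hsymm, real_inner_comm]
  rw [key]
  simp only [conormalField, sum_inner, inner_smul_left, Finset.sum_mul, Finset.mul_sum]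
  refine Finset.sum_congr rfl fun i _ => Finset.sum_congr rfl fun j _ => ?_
  simp; ring

/-- The divergence of the conormal fields, which is `√g` times the mean curvature vector, vanishes
where the mean curvature does. -/
theorem sum_fderiv_conormalField (hφ : ∀ᶠ v in 𝓝 u, ContDiffAt ℝ ∞ φ v)
    (hi : ∀ᶠ v in 𝓝 u, Function.Injective (fderiv ℝ φ v)) (hH : paramMeanCurvature φ u = 0) :
    ∑ i, fderiv ℝ (conormalField φ i) u (EuclideanSpace.single i 1) = 0 := by
  have hφu := hφ.self_of_nhds
  have hiu := hi.self_of_nhds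
  have hd : ∀ i, DifferentiableAt ℝ (fun v => coordDeriv φ v i) u := fun i =>
    (contDiffAt_coordDeriv hφu i).differentiableAt (by simp)
  have hW : ∀ i, DifferentiableAt ℝ (conormalField φ i) u := fun i =>
    (contDiffAt_conormalField hφu hiu i).differentiableAt (by simp)
  have hc : ∀ i j, DifferentiableAt ℝ (fun v => areaJacobian φ v * (metricMatrix φ v)⁻¹ i j) u :=
    fun i j => (contDiffAt_coeff hφu hiu i j).differentiableAt (by simp)
  set Z := ∑ i, fderiv ℝ (conormalField φ i) u (EuclideanSpace.single i 1) with hZ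
  -- The tangential part vanishes for every immersion: differentiating `⟨Wᵢ, ∂ₖφ⟩ = δᵢₖ√g` and
  -- summing over `i` leaves `∂ₖ√g - ∑ᵢ ⟨Wᵢ, ∂ᵢ∂ₖφ⟩`, which is zero by the formula for `∂ₖ√g`.
  have hperp : Z ∈ (tangentPlane φ u)ᗮ := by
    rw [tangentPlane, Submodule.mem_orthogonal]
    intro w hw
    induction hw using Submodule.span_induction with
    | zero => simp
    | add x y _ _ hx hy => rw [inner_add_left, hx, hy, add_zero]
    | smul a x _ hx => rw [inner_smul_left, hx, mul_zero]
    | mem x hx =>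
      obtain ⟨k, rfl⟩ := hx
      rw [real_inner_comm, hZ, sum_inner]
      have h1 : ∀ i, ⟪fderiv ℝ (conormalField φ i) u (EuclideanSpace.single i 1), coordDeriv φ u k⟫ =
          (if i = k then fderiv ℝ (areaJacobian φ) u (EuclideanSpace.single k 1) else 0) -
            ⟪conormalField φ i u, coordDeriv₂ φ u i k⟫ := by
        intro i
        have h2 := fderiv_inner_apply ℝ (hW i) (hd k) (EuclideanSpace.single i 1)
        have h3 : (fun v => ⟪conormalField φ i v, coordDeriv φ v k⟫) =ᶠ[𝓝 u]
            fun v => if i = k then areaJacobian φ v else 0 :=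
          hi.mono fun v hv => inner_conormalField hv i k
        rw [h3.fderiv_eq] at h2
        rw [eq_sub_iff_add_eq']
        refine Eq.trans h2.symm ?_
        split_ifs with h
        · rw [h]
        · simp
      simp only [h1, Finset.sum_sub_distrib]
      rw [Finset.sum_ite_eq' Finset.univ k, if_pos (Finset.mem_univ k), fderiv_areaJacobian hφu hiu]
      simp [coordDeriv₂_comm hφu]
  -- Derivatives falling on the coefficients give tangential terms, so the normal part is `√g ∑
  -- gⁱʲ(∂ᵢ∂ⱼφ)ᴺ`. This is the only use of minimality.
  have hN : (tangentPlane φ u)ᗮ.starProjection Z = 0 := by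
    have h1 : ∀ i, (tangentPlane φ u)ᗮ.starProjection
        (fderiv ℝ (conormalField φ i) u (EuclideanSpace.single i 1)) =
        areaJacobian φ u • ∑ j, (metricMatrix φ u)⁻¹ i j •
          (tangentPlane φ u)ᗮ.starProjection (coordDeriv₂ φ u i j) := by
      intro i
      have h2 : HasFDerivAt (conormalField φ i) _ u := HasFDerivAt.fun_sum fun j (_ : j ∈ Finset.univ) =>
        (hc i j).hasFDerivAt.smul (hd j).hasFDerivAt
      rw [h2.fderiv]
      simp only [_root_.sum_apply, map_sum, Finset.smul_sum]
      refine Finset.sum_congr rfl fun j _ => ?_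
      have h3 : (tangentPlane φ u)ᗮ.starProjection (coordDeriv φ u j) = 0 := by
        rw [Submodule.starProjection_apply_eq_zero_iff, Submodule.orthogonal_orthogonal]
        exact Submodule.subset_span ⟨j, rfl⟩
      simp only [_root_.add_apply, _root_.smul_apply,
        ContinuousLinearMap.smulRight_apply, map_add, map_smul, h3, smul_zero, add_zero, smul_smul]
      rfl
    rw [hZ, map_sum]
    simp only [h1]
    rw [← Finset.smul_sum]
    rw [paramMeanCurvature] at hH
    rw [hH, smul_zero]
  rwa [Submodule.starProjection_eq_self_iff.2 hperp] at hN

/-- The integrand is the divergence of `⟨Wᵢ, Y⟩`, because the term in which the derivatives fall on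
`Wᵢ` vanishes by minimality. Nothing is known of `φ` outside `U`, but there `Y` vanishes identically
near each point. -/
theorem integral_tangentialTrace_param {U : Set (𝔼 m)} (hU : IsOpen U) (hφ : ContDiffOn ℝ ∞ φ U)
    (hi : ∀ u ∈ U, Function.Injective (fderiv ℝ φ u)) (hH : ∀ u ∈ U, paramMeanCurvature φ u = 0)
    {Y : 𝔼 m → 𝔼 n} (hY : ContDiff ℝ 1 Y) (hYc : HasCompactSupport Y) (hYU : tsupport Y ⊆ U) :
    ∫ u, areaJacobian φ u * tangentialTrace (fderiv ℝ φ u) (fderiv ℝ Y u) = 0 := by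
  have hφ' : ∀ u ∈ U, ContDiffAt ℝ ∞ φ u := fun u hu => hφ.contDiffAt (hU.mem_nhds hu)
  let f : Fin m → 𝔼 m → ℝ := fun i u => ⟪conormalField φ i u, Y u⟫
  have hY0 : ∀ u, u ∉ tsupport Y → Y =ᶠ[𝓝 u] 0 := fun u hu => notMem_tsupport_iff_eventuallyEq.1 hu
  have hf0 : ∀ i u, u ∉ tsupport Y → f i =ᶠ[𝓝 u] 0 := fun i u hu =>
    (hY0 u hu).mono fun v hv => by simp [f, hv]
  have hf : ∀ i, ContDiff ℝ 1 (f i) := fun i => contDiff_iff_contDiffAt.2 fun u => by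
    by_cases hu : u ∈ tsupport Y
    · exact ((contDiffAt_conormalField (hφ' u (hYU hu)) (hi u (hYU hu)) i).of_le (by simp)).inner ℝ
        hY.contDiffAt
    · exact contDiffAt_const.congr_of_eventuallyEq (hf0 i u hu)
  have hfc : ∀ i, HasCompactSupport (f i) := fun i =>
    hYc.mono' fun u hu => by
      by_contra h
      exact hu (hf0 i u h).self_of_nhds
  have key : ∀ u, areaJacobian φ u * tangentialTrace (fderiv ℝ φ u) (fderiv ℝ Y u) =
      ∑ i, fderiv ℝ (f i) u (EuclideanSpace.single i 1) := by
    intro u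
    by_cases hu : u ∈ tsupport Y
    · have hev : ∀ᶠ v in 𝓝 u, v ∈ U := hU.mem_nhds (hYU hu)
      have hZ := sum_fderiv_conormalField (hev.mono hφ') (hev.mono hi) (hH u (hYU hu))
      have hW : ∀ i, DifferentiableAt ℝ (conormalField φ i) u := fun i =>
        (contDiffAt_conormalField (hφ' u (hYU hu)) (hi u (hYU hu)) i).differentiableAt (by simp)
      have hYd : DifferentiableAt ℝ Y u := hY.differentiable one_ne_zero u
      have h1 : ∀ i, fderiv ℝ (f i) u (EuclideanSpace.single i 1) =
          ⟪conormalField φ i u, fderiv ℝ Y u (EuclideanSpace.single i 1)⟫ +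
          ⟪fderiv ℝ (conormalField φ i) u (EuclideanSpace.single i 1), Y u⟫ := fun i =>
        fderiv_inner_apply ℝ (hW i) hYd _
      simp only [h1, Finset.sum_add_distrib]
      rw [← sum_inner, hZ, inner_zero_left, add_zero, tangentialTrace, Finset.mul_sum]
      refine Finset.sum_congr rfl fun i _ => ?_
      rw [conormalField, sum_inner, Finset.mul_sum]
      refine Finset.sum_congr rfl fun j _ => ?_
      rw [inner_smul_left, real_inner_comm]
      simp [metricMatrix_eq, coordDeriv]; ring
    · simp [(hf0 _ u hu).fderiv_eq, (hY0 u hu).fderiv_eq, tangentialTrace]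
  simp only [key]
  rw [integral_finsetSum]
  · exact Finset.sum_eq_zero fun i _ => integral_fderiv_eq_zero (hf i) (hfc i) _
  · intro i _
    exact (((hf i).continuous_fderiv one_ne_zero).clm_apply continuous_const).integrable_of_hasCompactSupport
      ((hfc i).fderiv_apply (𝕜 := ℝ) _)

end Param

/-! ### Invariance of the mean curvature under reparametrization -/

theorem tangentPlane_eq_range (φ : 𝔼 m → 𝔼 n) (u : 𝔼 m) :
    tangentPlane φ u = (fderiv ℝ φ u : 𝔼 m →ₗ[ℝ] 𝔼 n).range := by
  refine le_antisymm (Submodule.span_le.2 ?_) ?_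
  · rintro _ ⟨i, rfl⟩
    exact ⟨_, rfl⟩
  · rintro _ ⟨v, rfl⟩
    change fderiv ℝ φ u v ∈ _
    rw [apply_eq_sum (fderiv ℝ φ u) v]
    exact Submodule.sum_mem _ fun i _ => Submodule.smul_mem _ _ (Submodule.subset_span ⟨i, rfl⟩)

theorem surjective_of_det_ne_zero {S : 𝔼 m →L[ℝ] 𝔼 m} (hS : S.det ≠ 0) : Function.Surjective S := by
  have := (LinearMap.equivOfDetNeZero (S : 𝔼 m →ₗ[ℝ] 𝔼 m) hS).surjective
  exact this

/-- The second derivative of `φ ∘ τ` is `D²φ(S·, S·)` plus a term in the range of `Dφ`, which the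
normal projection kills; the factors `S` are absorbed by `S g_ψ⁻¹ Sᵀ = g_φ⁻¹`. Minimality is assumed
at each point in its own preferred chart, whereas the integration by parts needs it throughout a
single chart. -/
theorem paramMeanCurvature_comp {φ ψ : 𝔼 m → 𝔼 n} {τ : 𝔼 m → 𝔼 m} {u : 𝔼 m} (hτ : ContDiffAt ℝ ∞ τ u)
    (hφ : ContDiffAt ℝ ∞ φ (τ u)) (hS : (fderiv ℝ τ u).det ≠ 0) (hψ : ψ =ᶠ[𝓝 u] φ ∘ τ) :
    paramMeanCurvature ψ u = paramMeanCurvature φ (τ u) := by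
  set S := fderiv ℝ τ u with hSdef
  have hτd : DifferentiableAt ℝ τ u := hτ.differentiableAt (by simp)
  have hφd : DifferentiableAt ℝ φ (τ u) := hφ.differentiableAt (by simp)
  have hev : ∀ᶠ v in 𝓝 u, fderiv ℝ ψ v = (fderiv ℝ φ (τ v)).comp (fderiv ℝ τ v) := by
    have h1 : ∀ᶠ v in 𝓝 u, DifferentiableAt ℝ τ v :=
      ((hτ.of_le (m := 1) (by simp)).eventually (by simp)).mono fun v hv => hv.differentiableAt one_ne_zero
    have h2 : ∀ᶠ v in 𝓝 u, DifferentiableAt ℝ φ (τ v) := hτd.continuousAt.eventually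
      (((hφ.of_le (m := 1) (by simp)).eventually (by simp)).mono
        fun v hv => hv.differentiableAt one_ne_zero)
    filter_upwards [h1, h2, hψ.eventuallyEq_nhds] with v hv1 hv2 hv3
    rw [hv3.fderiv_eq, fderiv_comp v hv2 hv1]
  have hDψ : fderiv ℝ ψ u = (fderiv ℝ φ (τ u)).comp S := hev.self_of_nhds
  have hT : tangentPlane ψ u = tangentPlane φ (τ u) := by
    rw [tangentPlane_eq_range, tangentPlane_eq_range, hDψ]
    exact LinearMap.range_comp_of_range_eq_top _
      (LinearMap.range_eq_top.2 (surjective_of_det_ne_zero hS))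
  have hN : ∀ v, (tangentPlane φ (τ u))ᗮ.starProjection (fderiv ℝ φ (τ u) v) = 0 := fun v => by
    rw [Submodule.starProjection_apply_eq_zero_iff, Submodule.orthogonal_orthogonal,
      tangentPlane_eq_range]
    exact ⟨v, rfl⟩
  have hD2 : DifferentiableAt ℝ (fderiv ℝ φ) (τ u) :=
    (hφ.fderiv_right (m := ∞) (by simp)).differentiableAt (by simp)
  have hτ2 : DifferentiableAt ℝ (fderiv ℝ τ) u :=
    (hτ.fderiv_right (m := ∞) (by simp)).differentiableAt (by simp)
  let h : Fin m → Fin m → 𝔼 n := fun k l =>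
    (tangentPlane φ (τ u))ᗮ.starProjection (coordDeriv₂ φ (τ u) k l)
  have hsecond : ∀ i j, (tangentPlane ψ u)ᗮ.starProjection (coordDeriv₂ ψ u i j) =
      ∑ k, ∑ l, (coordMatrix S k i * coordMatrix S l j) • h k l := by
    intro i j
    have h1 : (fun v => coordDeriv ψ v j) =ᶠ[𝓝 u]
        fun v => fderiv ℝ φ (τ v) (fderiv ℝ τ v (EuclideanSpace.single j 1)) :=
      hev.mono fun v hv => by simp only [coordDeriv, hv]; rfl
    have h2 : DifferentiableAt ℝ (fun v => fderiv ℝ φ (τ v)) u := hD2.comp u hτd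
    have h3 : DifferentiableAt ℝ (fun v => fderiv ℝ τ v (EuclideanSpace.single j 1)) u :=
      hτ2.clm_apply (differentiableAt_const _)
    have h4 : fderiv ℝ (fun v => fderiv ℝ φ (τ v)) u = (fderiv ℝ (fderiv ℝ φ) (τ u)).comp S :=
      fderiv_comp u hD2 hτd
    rw [hT, coordDeriv₂, h1.fderiv_eq, fderiv_clm_apply h2 h3, h4]
    simp only [_root_.add_apply, ContinuousLinearMap.comp_apply, map_add, hN, zero_add,
      ContinuousLinearMap.flip_apply]
    rw [apply_eq_sum (fderiv ℝ (fderiv ℝ φ) (τ u))]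
    simp only [_root_.sum_apply, map_sum, _root_.smul_apply, map_smul]
    refine Finset.sum_congr rfl fun k _ => ?_
    rw [apply_eq_sum (fderiv ℝ (fderiv ℝ φ) (τ u) _)]
    simp only [map_sum, map_smul, Finset.smul_sum, smul_smul, ← hSdef]
    refine Finset.sum_congr rfl fun l _ => ?_
    simp only [h, coordDeriv₂_eq hφ]
    rfl
  rw [paramMeanCurvature, paramMeanCurvature]
  simp only [hsecond, Finset.smul_sum, smul_smul]
  have hu := isUnit_coordMatrix hS
  have hinv : ∀ k l, ∑ i, ∑ j, (metricMatrix ψ u)⁻¹ i j * (coordMatrix S k i * coordMatrix S l j) =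
      (metricMatrix φ (τ u))⁻¹ k l := by
    intro k l
    have h1 : coordMatrix S * (metricMatrix ψ u)⁻¹ * (coordMatrix S).transpose =
        (metricMatrix φ (τ u))⁻¹ := by
      have huT : IsUnit (coordMatrix S).transpose.det := by simpa using hu
      rw [metricMatrix_eq, hDψ, gramMatrix_comp, Matrix.mul_inv_rev, Matrix.mul_inv_rev,
        ← metricMatrix_eq, Matrix.mul_nonsing_inv_cancel_left _ _ hu, Matrix.mul_assoc,
        Matrix.nonsing_inv_mul _ huT, Matrix.mul_one]
    rw [← h1]
    simp only [Matrix.mul_apply, Matrix.transpose_apply, Finset.sum_mul]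
    rw [Finset.sum_comm]
    exact Finset.sum_congr rfl fun i _ => Finset.sum_congr rfl fun j _ => by ring
  calc _ = ∑ k, ∑ l, ∑ i, ∑ j,
        ((metricMatrix ψ u)⁻¹ i j * (coordMatrix S k i * coordMatrix S l j)) • h k l := by
        simp only [← Finset.sum_product']
        refine Finset.sum_bij' (fun p _ => (p.2.2.1, p.2.2.2, p.1, p.2.1))
          (fun p _ => (p.2.2.1, p.2.2.2, p.1, p.2.1)) ?_ ?_ ?_ ?_ ?_ <;> simp
    _ = _ := by
        refine Finset.sum_congr rfl fun k _ => Finset.sum_congr rfl fun l _ => ?_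
        simp only [← Finset.sum_smul, hinv]
        rfl

/-! ### Changes of chart -/

section Manifold

variable {M : Type*} [TopologicalSpace M] [ChartedSpace (𝔼 m) M]

/-- The transition map from the chart at `x` to the chart at `y`. -/
noncomputable def chartTransition (m : ℕ) {M : Type*} [TopologicalSpace M] [ChartedSpace (𝔼 m) M] (x y : M) :
    𝔼 m → 𝔼 m :=
  chartAt (𝔼 m) y ∘ (chartAt (𝔼 m) x).symm

theorem chartTransition_chartAt {x y z : M} (hz : z ∈ (chartAt (𝔼 m) x).source) :
    chartTransition m x y (chartAt (𝔼 m) x z) = chartAt (𝔼 m) y z := by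
  simp [chartTransition, (chartAt (𝔼 m) x).left_inv hz]

theorem localParam_chartAt (F : M → 𝔼 n) {x z : M} (hz : z ∈ (chartAt (𝔼 m) x).source) :
    localParam F x (chartAt (𝔼 m) x z) = F z := by
  simp [localParam, (chartAt (𝔼 m) x).left_inv hz]

theorem localParam_eventuallyEq (F : M → 𝔼 n) {x y z : M} (hx : z ∈ (chartAt (𝔼 m) x).source)
    (hy : z ∈ (chartAt (𝔼 m) y).source) :
    localParam F x =ᶠ[𝓝 (chartAt (𝔼 m) x z)] localParam F y ∘ chartTransition m x y := by
  have h : ∀ᶠ u in 𝓝 (chartAt (𝔼 m) x z), (chartAt (𝔼 m) x).symm u ∈ (chartAt (𝔼 m) y).source := by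
    refine ((chartAt (𝔼 m) x).continuousAt_symm ((chartAt (𝔼 m) x).map_source hx)).eventually_mem ?_
    rw [(chartAt (𝔼 m) x).left_inv hx]
    exact (chartAt (𝔼 m) y).open_source.mem_nhds hy
  filter_upwards [h] with u hu
  simp [localParam, chartTransition, (chartAt (𝔼 m) y).left_inv hu]

theorem chartTransition_comp_eventuallyEq {x y z : M} (hx : z ∈ (chartAt (𝔼 m) x).source)
    (hy : z ∈ (chartAt (𝔼 m) y).source) :
    chartTransition m y x ∘ chartTransition m x y =ᶠ[𝓝 (chartAt (𝔼 m) x z)] id := by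
  have h : ∀ᶠ u in 𝓝 (chartAt (𝔼 m) x z), (chartAt (𝔼 m) x).symm u ∈ (chartAt (𝔼 m) y).source := by
    refine ((chartAt (𝔼 m) x).continuousAt_symm ((chartAt (𝔼 m) x).map_source hx)).eventually_mem ?_
    rw [(chartAt (𝔼 m) x).left_inv hx]
    exact (chartAt (𝔼 m) y).open_source.mem_nhds hy
  filter_upwards [h, (chartAt (𝔼 m) x).open_target.mem_nhds ((chartAt (𝔼 m) x).map_source hx)]
    with u hu hu'
  simp [chartTransition, (chartAt (𝔼 m) y).left_inv hu, (chartAt (𝔼 m) x).right_inv hu']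

section Smooth

variable [IsManifold (𝓡 m) ∞ M]

theorem contDiffAt_chartTransition {x y z : M} (hx : z ∈ (chartAt (𝔼 m) x).source)
    (hy : z ∈ (chartAt (𝔼 m) y).source) :
    ContDiffAt ℝ ∞ (chartTransition m x y) (chartAt (𝔼 m) x z) := by
  rw [← contMDiffAt_iff_contDiffAt]
  have h1 : ContMDiffAt (𝓡 m) (𝓡 m) ∞ (chartAt (𝔼 m) x).symm (chartAt (𝔼 m) x z) :=
    (contMDiffOn_chart_symm (I := 𝓡 m)).contMDiffAt
      ((chartAt (𝔼 m) x).open_target.mem_nhds ((chartAt (𝔼 m) x).map_source hx))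
  have h2 : ContMDiffAt (𝓡 m) (𝓡 m) ∞ (chartAt (𝔼 m) y)
      ((chartAt (𝔼 m) x).symm (chartAt (𝔼 m) x z)) := by
    rw [(chartAt (𝔼 m) x).left_inv hx]
    exact (contMDiffOn_chart (I := 𝓡 m)).contMDiffAt ((chartAt (𝔼 m) y).open_source.mem_nhds hy)
  exact h2.comp _ h1

/-- The reverse transition is a local inverse, so by the chain rule the product of the two
determinants is `1`. -/
theorem det_fderiv_chartTransition_ne_zero {x y z : M} (hx : z ∈ (chartAt (𝔼 m) x).source)
    (hy : z ∈ (chartAt (𝔼 m) y).source) :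
    (fderiv ℝ (chartTransition m x y) (chartAt (𝔼 m) x z)).det ≠ 0 := by
  have h1 := (contDiffAt_chartTransition hx hy).differentiableAt (by simp)
  have h2 := (contDiffAt_chartTransition hy hx).differentiableAt (by simp)
  rw [← chartTransition_chartAt hx] at h2
  have h3 := (chartTransition_comp_eventuallyEq hx hy).fderiv_eq (𝕜 := ℝ)
  rw [fderiv_comp _ h2 h1, fderiv_id] at h3
  intro h
  have h4 := congrArg ContinuousLinearMap.det h3
  have h5 : ∀ A B : 𝔼 m →L[ℝ] 𝔼 m, (A.comp B).det = A.det * B.det := fun A B =>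
    LinearMap.det_comp _ _
  rw [h5, h, mul_zero] at h4
  have h6 : (ContinuousLinearMap.id ℝ (𝔼 m)).det = 1 := LinearMap.det_id
  rw [h6] at h4
  exact zero_ne_one h4

theorem contDiffOn_localParam {r : WithTop ℕ∞} (hr : r ≤ (∞ : WithTop ℕ∞)) {Y : M → 𝔼 n}
    (hY : ContMDiff (𝓡 m) (𝓡 n) r Y) (x : M) :
    ContDiffOn ℝ r (localParam Y x) (chartAt (𝔼 m) x).target := by
  rw [← contMDiffOn_iff_contDiffOn]
  exact hY.comp_contMDiffOn ((contMDiffOn_chart_symm (I := 𝓡 m) (n := ∞)).of_le hr)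

theorem contDiffAt_localParam {r : WithTop ℕ∞} (hr : r ≤ (∞ : WithTop ℕ∞)) {Y : M → 𝔼 n}
    (hY : ContMDiff (𝓡 m) (𝓡 n) r Y) {x z : M} (hz : z ∈ (chartAt (𝔼 m) x).source) :
    ContDiffAt ℝ r (localParam Y x) (chartAt (𝔼 m) x z) :=
  (contDiffOn_localParam hr hY x).contDiffAt
    ((chartAt (𝔼 m) x).open_target.mem_nhds ((chartAt (𝔼 m) x).map_source hz))

theorem fderiv_localParam {Y : M → 𝔼 n} (hY : ContMDiff (𝓡 m) (𝓡 n) 1 Y) {x y z : M}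
    (hx : z ∈ (chartAt (𝔼 m) x).source) (hy : z ∈ (chartAt (𝔼 m) y).source) :
    fderiv ℝ (localParam Y x) (chartAt (𝔼 m) x z) =
      (fderiv ℝ (localParam Y y) (chartAt (𝔼 m) y z)).comp
        (fderiv ℝ (chartTransition m x y) (chartAt (𝔼 m) x z)) := by
  have h1 := (contDiffAt_chartTransition hx hy).differentiableAt (by simp)
  have h2 := (contDiffAt_localParam (by simp) hY hy).differentiableAt one_ne_zero
  rw [← chartTransition_chartAt hx] at h2
  rw [(localParam_eventuallyEq Y hx hy).fderiv_eq, fderiv_comp _ h2 h1, chartTransition_chartAt hx]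

theorem areaJacobian_localParam {F : M → 𝔼 n} (hF : ContMDiff (𝓡 m) (𝓡 n) 1 F) {x y z : M}
    (hx : z ∈ (chartAt (𝔼 m) x).source) (hy : z ∈ (chartAt (𝔼 m) y).source) :
    areaJacobian (localParam F x) (chartAt (𝔼 m) x z) =
      |(fderiv ℝ (chartTransition m x y) (chartAt (𝔼 m) x z)).det| *
        areaJacobian (localParam F y) (chartAt (𝔼 m) y z) := by
  rw [areaJacobian_eq, fderiv_localParam hF hx hy, sqrt_det_gramMatrix_comp, areaJacobian_eq]

theorem IsProperMinimalImmersion.injective_fderiv {F : M → 𝔼 n} (hF : IsProperMinimalImmersion m F)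
    {x z : M} (hz : z ∈ (chartAt (𝔼 m) x).source) :
    Function.Injective (fderiv ℝ (localParam F x) (chartAt (𝔼 m) x z)) := by
  have ht := (chartAt (𝔼 m) x).map_source hz
  have hz' : (chartAt (𝔼 m) x).symm (chartAt (𝔼 m) x z) = z := (chartAt (𝔼 m) x).left_inv hz
  have : IsManifold (𝓡 m) 1 M := IsManifold.of_le (n := ∞) (by simp)
  have hchart := mdifferentiable_chart (I := 𝓡 m) x
  have h1 : MDifferentiableAt (𝓡 m) (𝓡 n) F ((chartAt (𝔼 m) x).symm (chartAt (𝔼 m) x z)) :=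
    hF.contMDiff.mdifferentiableAt (by simp)
  have h3 := mfderiv_comp (chartAt (𝔼 m) x z) h1 (hchart.symm.mdifferentiableAt ht)
  have h4 : mfderiv (𝓡 m) (𝓡 n) (localParam F x) (chartAt (𝔼 m) x z) =
    fderiv ℝ (localParam F x) (chartAt (𝔼 m) x z) := mfderiv_eq_fderiv
  rw [← h4]
  erw [h3]
  exact (hF.immersion _).comp (hchart.symm.mfderiv_injective ht)

theorem IsProperMinimalImmersion.paramMeanCurvature_eq_zero {F : M → 𝔼 n}
    (hF : IsProperMinimalImmersion m F) {x z : M} (hz : z ∈ (chartAt (𝔼 m) x).source) :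
    paramMeanCurvature (localParam F x) (chartAt (𝔼 m) x z) = 0 := by
  have hzz := mem_chart_source (𝔼 m) z
  have h2 := contDiffAt_localParam le_rfl hF.contMDiff hzz
  rw [← chartTransition_chartAt hz] at h2
  rw [paramMeanCurvature_comp (contDiffAt_chartTransition hz hzz) h2
    (det_fderiv_chartTransition_ne_zero hz hzz) (localParam_eventuallyEq F hz hzz),
    chartTransition_chartAt hz]
  exact hF.minimal z

end Smooth

end Manifold

/-! ### The area measure: independence of charts, countable decomposition, local finiteness -/

theorem measurableSet_inter_preimage_of_continuousOn {X Y : Type*} [TopologicalSpace X] [MeasurableSpace X]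
    [BorelSpace X] [TopologicalSpace Y] [MeasurableSpace Y] [BorelSpace Y] {f : X → Y} {s : Set X}
    (hf : ContinuousOn f s) (hs : MeasurableSet s) {t : Set Y} (ht : MeasurableSet t) :
    MeasurableSet (s ∩ f ⁻¹' t) := by
  have h1 : Measurable (s.domRestrict f) := hf.domRestrict.measurable
  have h2 := (MeasurableEmbedding.subtype_coe hs).measurableSet_image.2 (h1 ht)
  convert h2 using 1
  ext x; simp [and_comm, Set.domRestrict]

section Area

variable {M : Type*} [TopologicalSpace M] [ChartedSpace (𝔼 m) M] [MeasurableSpace M] [BorelSpace M]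

theorem aemeasurable_chartAt_symm (F : M → 𝔼 n) (x : M) :
    AEMeasurable (chartAt (𝔼 m) x).symm (((volume : Measure (𝔼 m)).restrict
      (chartAt (𝔼 m) x).target).withDensity fun u => ENNReal.ofReal (areaJacobian (localParam F x) u)) :=
  ((chartAt (𝔼 m) x).continuousOn_symm.aemeasurable (chartAt (𝔼 m) x).open_target.measurableSet).mono_ac
    (withDensity_absolutelyContinuous _ _)

theorem chartArea_apply (F : M → 𝔼 n) (x : M) {A : Set M} (hA : MeasurableSet A) :
    chartArea (m := m) F x A = ∫⁻ u in (chartAt (𝔼 m) x).target ∩ (chartAt (𝔼 m) x).symm ⁻¹' A,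
      ENNReal.ofReal (areaJacobian (localParam F x) u) := by
  rw [chartArea, Measure.map_apply_of_aemeasurable (aemeasurable_chartAt_symm F x) hA,
    withDensity_apply', Measure.restrict_restrict' (chartAt (𝔼 m) x).open_target.measurableSet, inter_comm]

theorem chartArea_inter_source (F : M → 𝔼 n) (x : M) {A : Set M} (hA : MeasurableSet A) :
    chartArea (m := m) F x (A ∩ (chartAt (𝔼 m) x).source) = chartArea (m := m) F x A := by
  rw [chartArea_apply F x hA,
    chartArea_apply F x (hA.inter (chartAt (𝔼 m) x).open_source.measurableSet)]
  congr 2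
  ext u
  simp only [mem_inter_iff, mem_preimage]
  exact ⟨fun h => ⟨h.1, h.2.1⟩, fun h => ⟨h.1, h.2, (chartAt (𝔼 m) x).map_target h.1⟩⟩

section Smooth

variable [IsManifold (𝓡 m) ∞ M] {F : M → 𝔼 n}

/-- Change of variables along the transition map, whose determinant is the ratio of the two
Jacobians. -/
theorem chartArea_eq (hF : ContMDiff (𝓡 m) (𝓡 n) 1 F) {x y : M} {A : Set M} (hA : MeasurableSet A)
    (hx : A ⊆ (chartAt (𝔼 m) x).source) (hy : A ⊆ (chartAt (𝔼 m) y).source) :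
    chartArea (m := m) F x A = chartArea (m := m) F y A := by
  have himage : ∀ z : M, A ⊆ (chartAt (𝔼 m) z).source →
      (chartAt (𝔼 m) z).target ∩ (chartAt (𝔼 m) z).symm ⁻¹' A = chartAt (𝔼 m) z '' A := by
    intro z hz
    rw [← (chartAt (𝔼 m) z).image_eq_target_inter_inv_preimage hz]
  have hmeas : MeasurableSet (chartAt (𝔼 m) x '' A) := by
    rw [← himage x hx]
    exact measurableSet_inter_preimage_of_continuousOn (chartAt (𝔼 m) x).continuousOn_symm
      (chartAt (𝔼 m) x).open_target.measurableSet hA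
  have htrans : chartAt (𝔼 m) y '' A = chartTransition m x y '' (chartAt (𝔼 m) x '' A) := by
    rw [image_image]
    exact image_congr fun z hz => (chartTransition_chartAt (hx hz)).symm
  have hinj : InjOn (chartTransition m x y) (chartAt (𝔼 m) x '' A) := by
    rintro _ ⟨z, hz, rfl⟩ _ ⟨w, hw, rfl⟩ h
    rw [chartTransition_chartAt (hx hz), chartTransition_chartAt (hx hw)] at h
    rw [(chartAt (𝔼 m) y).injOn (hy hz) (hy hw) h]
  rw [chartArea_apply F x hA, chartArea_apply F y hA, himage x hx, himage y hy, htrans,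
    lintegral_image_eq_lintegral_abs_det_fderiv_mul volume hmeas
      (f' := fun u => fderiv ℝ (chartTransition m x y) u) ?_ hinj]
  · refine setLIntegral_congr_fun hmeas ?_
    rintro _ ⟨z, hz, rfl⟩
    simp only
    rw [areaJacobian_localParam hF (hx hz) (hy hz), chartTransition_chartAt (hx hz),
      ENNReal.ofReal_mul (abs_nonneg _)]
  · rintro _ ⟨z, hz, rfl⟩
    exact ((contDiffAt_chartTransition (hx hz) (hy hz)).differentiableAt
      (by simp)).hasFDerivAt.hasFDerivWithinAt

variable (m M) in
theorem exists_seq_chartAt_source [SecondCountableTopology M] [Nonempty M] :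
    ∃ x : ℕ → M, ⋃ i, (chartAt (𝔼 m) (x i)).source = univ := by
  obtain ⟨s, hs, hU⟩ := TopologicalSpace.countable_cover_nhds (chart_source_mem_nhds (𝔼 m) (M := M))
  have hne : s.Nonempty := by
    by_contra h
    rw [not_nonempty_iff_eq_empty] at h
    simp [h, eq_comm (a := (∅ : Set M))] at hU
  obtain ⟨x, rfl⟩ := hs.exists_eq_range hne
  exact ⟨x, by simpa using hU⟩

variable [SecondCountableTopology M] [Nonempty M]

/-- The area measure is a countable sum of pieces, each of them parametrized by one chart. -/
theorem exists_areaMeasure_eq_sum (hF : ContMDiff (𝓡 m) (𝓡 n) 1 F) :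
    ∃ (x : ℕ → M) (A : ℕ → Set M), (∀ i, MeasurableSet (A i)) ∧
      (∀ i, A i ⊆ (chartAt (𝔼 m) (x i)).source) ∧ Pairwise (Function.onFun Disjoint A) ∧ ⋃ i, A i = univ ∧
      areaMeasure m F = Measure.sum fun i => (chartArea (m := m) F (x i)).restrict (A i) := by
  obtain ⟨x, hx⟩ := exists_seq_chartAt_source m M
  -- Countably many chart domains cover `M`; making them disjoint lets each piece be measured in one
  -- chart without counting overlaps twice.
  let A := disjointed fun i => (chartAt (𝔼 m) (x i)).source
  have hAm : ∀ i, MeasurableSet (A i) := fun i =>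
    MeasurableSet.disjointed (fun i => (chartAt (𝔼 m) (x i)).open_source.measurableSet) i
  have hAs : ∀ i, A i ⊆ (chartAt (𝔼 m) (x i)).source := fun i => disjointed_subset _ i
  have hAd : Pairwise (Function.onFun Disjoint A) := disjoint_disjointed _
  have hAU : ⋃ i, A i = univ := by rw [← hx]; exact iUnion_disjointed
  have hsplit : ∀ (μ : Measure M) (s : Set M), MeasurableSet s → μ s = ∑' i, μ (s ∩ A i) := by
    intro μ s hs
    rw [← measure_iUnion (fun i j hij => (hAd hij).mono inter_subset_right inter_subset_right)
      fun i => hs.inter (hAm i), ← inter_iUnion, hAU, inter_univ]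
  refine ⟨x, A, hAm, hAs, hAd, hAU, le_antisymm (iSup_le fun y => Measure.le_iff.2 fun s hs => ?_)
    (Measure.le_iff.2 fun s hs => ?_)⟩
  -- The measure of an arbitrary chart is cut along the pieces, and on each of them it agrees with
  -- the measure of the chart chosen there.
  · have hso := (chartAt (𝔼 m) y).open_source.measurableSet
    rw [← chartArea_inter_source F y hs, hsplit _ _ (hs.inter hso), Measure.sum_apply _ hs]
    refine ENNReal.tsum_le_tsum fun i => ?_
    rw [Measure.restrict_apply hs, chartArea_eq hF ((hs.inter hso).inter (hAm i))
      (fun z hz => hz.1.2) fun z hz => hAs i hz.2]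
    exact measure_mono fun z hz => ⟨hz.1.1, hz.2⟩
  · rw [hsplit (areaMeasure m F) s hs, Measure.sum_apply _ hs]
    refine ENNReal.tsum_le_tsum fun i => ?_
    rw [Measure.restrict_apply hs]
    exact le_iSup (fun y => chartArea (m := m) F y) (x i) _

theorem areaMeasure_restrict_source (hF : ContMDiff (𝓡 m) (𝓡 n) 1 F) (x : M) :
    (areaMeasure m F).restrict (chartAt (𝔼 m) x).source = chartArea (m := m) F x := by
  obtain ⟨y, A, hAm, hAs, hAd, hAU, h⟩ := exists_areaMeasure_eq_sum hF
  ext s hs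
  have hso := (chartAt (𝔼 m) x).open_source.measurableSet
  rw [Measure.restrict_apply hs, h, Measure.sum_apply _ (hs.inter hso), ← chartArea_inter_source F x hs]
  have : chartArea (m := m) F x (s ∩ (chartAt (𝔼 m) x).source) =
      ∑' i, chartArea (m := m) F x (s ∩ (chartAt (𝔼 m) x).source ∩ A i) := by
    rw [← measure_iUnion (fun i j hij => (hAd hij).mono inter_subset_right inter_subset_right)
      fun i => (hs.inter hso).inter (hAm i), ← inter_iUnion, hAU, inter_univ]
  rw [this]
  refine tsum_congr fun i => ?_
  rw [Measure.restrict_apply (hs.inter hso)]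
  exact chartArea_eq hF ((hs.inter hso).inter (hAm i)) (fun z hz => hAs i hz.2) fun z hz => hz.1.2

theorem areaMeasure_apply_of_subset_source (hF : ContMDiff (𝓡 m) (𝓡 n) 1 F) {x : M} {A : Set M}
    (hA : MeasurableSet A) (hx : A ⊆ (chartAt (𝔼 m) x).source) :
    areaMeasure m F A = ∫⁻ u in (chartAt (𝔼 m) x).target ∩ (chartAt (𝔼 m) x).symm ⁻¹' A,
      ENNReal.ofReal (areaJacobian (localParam F x) u) := by
  rw [← chartArea_apply F x hA, ← areaMeasure_restrict_source hF x, Measure.restrict_apply hA,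
    inter_eq_left.2 hx]

theorem integral_areaMeasure (hF : ContMDiff (𝓡 m) (𝓡 n) 1 F)
    (hJ : ∀ x : M, ContinuousOn (areaJacobian (localParam F x)) (chartAt (𝔼 m) x).target) {x : M} {f : M → ℝ}
    (hf : Continuous f) (hs : ∀ z, z ∉ (chartAt (𝔼 m) x).source → f z = 0) :
    ∫ z, f z ∂(areaMeasure m F) = ∫ u in (chartAt (𝔼 m) x).target,
      areaJacobian (localParam F x) u * f ((chartAt (𝔼 m) x).symm u) := by
  rw [← setIntegral_eq_integral_of_forall_compl_eq_zero hs, areaMeasure_restrict_source hF, chartArea,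
    integral_map (aemeasurable_chartAt_symm F x) hf.measurable.aestronglyMeasurable]
  have hmeas : AEMeasurable (fun u => ENNReal.ofReal (areaJacobian (localParam F x) u))
      ((volume : Measure (𝔼 m)).restrict (chartAt (𝔼 m) x).target) :=
    ((hJ x).aemeasurable (chartAt (𝔼 m) x).open_target.measurableSet).ennreal_ofReal
  rw [integral_withDensity_eq_integral_toReal_smul₀ hmeas (by simp)]
  refine integral_congr_ae (Eventually.of_forall fun u => ?_)
  simp only [smul_eq_mul]
  rw [ENNReal.toReal_ofReal (areaJacobian_nonneg _ _)]

theorem isLocallyFiniteMeasure_areaMeasure (hF : ContMDiff (𝓡 m) (𝓡 n) 1 F)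
    (hJ : ∀ x : M, ContinuousOn (areaJacobian (localParam F x)) (chartAt (𝔼 m) x).target) :
    IsLocallyFiniteMeasure (areaMeasure m F) := by
  refine ⟨fun x => ?_⟩
  have hx := mem_chart_source (𝔼 m) x
  have ht := (chartAt (𝔼 m) x).open_target.mem_nhds ((chartAt (𝔼 m) x).map_source hx)
  obtain ⟨K, hK, hKt, hKc⟩ := local_compact_nhds ht
  have hN : (chartAt (𝔼 m) x).source ∩ chartAt (𝔼 m) x ⁻¹' interior K ∈ 𝓝 x :=
    inter_mem ((chartAt (𝔼 m) x).open_source.mem_nhds hx)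
      (((chartAt (𝔼 m) x).continuousAt hx).preimage_mem_nhds (interior_mem_nhds.2 hK))
  refine ⟨_, hN, ?_⟩
  rw [areaMeasure_apply_of_subset_source hF
    ((chartAt (𝔼 m) x).isOpen_inter_preimage isOpen_interior).measurableSet inter_subset_left]
  have hint : IntegrableOn (areaJacobian (localParam F x)) K :=
    ((hJ x).mono hKt).integrableOn_compact hKc
  refine lt_of_le_of_lt (lintegral_mono_set (t := K) ?_) ?_
  · rintro u ⟨hu, -, hu'⟩
    rw [mem_preimage, (chartAt (𝔼 m) x).right_inv hu] at hu'
    exact interior_subset hu'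
  · exact hint.lintegral_lt_top

end Smooth

end Area

/-! ### Tangential divergence and the first variation formula -/

theorem continuousAt_tangentialTrace {φ Y : 𝔼 m → 𝔼 n} {u : 𝔼 m} (hφ : ContDiffAt ℝ ∞ φ u)
    (hi : Function.Injective (fderiv ℝ φ u)) (hY : ContDiffAt ℝ 1 Y u) :
    ContinuousAt (fun v => tangentialTrace (fderiv ℝ φ v) (fderiv ℝ Y v)) u := by
  have h1 : ContinuousAt (fderiv ℝ Y) u := (hY.fderiv_right (m := 0) (by simp)).continuousAt
  have h2 : ContinuousAt (fderiv ℝ φ) u := (hφ.fderiv_right (m := 0) (by simp)).continuousAt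
  refine tendsto_finsetSum _ fun i _ => tendsto_finsetSum _ fun j _ => ?_
  refine ContinuousAt.mul (f := fun v => (metricMatrix φ v)⁻¹ i j) ?_ ?_
  · exact (contDiffAt_inv_apply (contDiffAt_metricMatrix hφ) (gramMatrix_det_pos hi).ne' i j).continuousAt
  · exact (h1.clm_apply continuousAt_const).inner (h2.clm_apply continuousAt_const)

section Manifold

variable {M : Type*} [TopologicalSpace M] [ChartedSpace (𝔼 m) M]

/-- The tangential divergence of a vector field `Y` along the immersion `F`. -/
noncomputable def tangentialDiv (m : ℕ) {n : ℕ} {M : Type*} [TopologicalSpace M] [ChartedSpace (𝔼 m) M]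
    (F Y : M → 𝔼 n) (z : M) : ℝ :=
  tangentialTrace (fderiv ℝ (localParam F z) (chartAt (𝔼 m) z z))
    (fderiv ℝ (localParam Y z) (chartAt (𝔼 m) z z))

variable [IsManifold (𝓡 m) ∞ M] {F : M → 𝔼 n}

/-- The defining chart varies with `z`; here a single chart serves a whole neighbourhood, as
continuity and integration require. -/
theorem tangentialDiv_eq (hF : ContMDiff (𝓡 m) (𝓡 n) 1 F) {Y : M → 𝔼 n} (hY : ContMDiff (𝓡 m) (𝓡 n) 1 Y)
    {x z : M} (hz : z ∈ (chartAt (𝔼 m) x).source) :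
    tangentialDiv m F Y z = tangentialTrace (fderiv ℝ (localParam F x) (chartAt (𝔼 m) x z))
      (fderiv ℝ (localParam Y x) (chartAt (𝔼 m) x z)) := by
  have hzz := mem_chart_source (𝔼 m) z
  rw [tangentialDiv, fderiv_localParam hF hzz hz, fderiv_localParam hY hzz hz,
    tangentialTrace_comp _ _ (det_fderiv_chartTransition_ne_zero hzz hz)]

theorem tangentialDiv_eq_zero (F : M → 𝔼 n) {Y : M → 𝔼 n} {z : M} (hz : z ∉ tsupport Y) :
    tangentialDiv m F Y z = 0 := by
  have h1 : ∀ᶠ w in 𝓝 z, Y w = 0 := notMem_tsupport_iff_eventuallyEq.1 hz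
  have h2 : localParam Y z =ᶠ[𝓝 (chartAt (𝔼 m) z z)] fun _ => (0 : 𝔼 n) := by
    refine ((chartAt (𝔼 m) z).continuousAt_symm (mem_chart_target (𝔼 m) z)).eventually (p := fun w => Y w = 0) ?_
    rwa [(chartAt (𝔼 m) z).left_inv (mem_chart_source (𝔼 m) z)]
  rw [tangentialDiv, h2.fderiv_eq]
  simp [tangentialTrace]

theorem tangentialDiv_sum (F : M → 𝔼 n) {ι : Type*} (s : Finset ι) {Y : ι → M → 𝔼 n}
    (hY : ∀ i ∈ s, ContMDiff (𝓡 m) (𝓡 n) 1 (Y i)) (z : M) :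
    tangentialDiv m F (fun w => ∑ i ∈ s, Y i w) z = ∑ i ∈ s, tangentialDiv m F (Y i) z := by
  have h : ∀ i ∈ s, DifferentiableAt ℝ (localParam (m := m) (Y i) z) (chartAt (𝔼 m) z z) := fun i hi =>
    (contDiffAt_localParam (by simp) (hY i hi) (mem_chart_source (𝔼 m) z)).differentiableAt one_ne_zero
  have h2 : localParam (m := m) (fun w => ∑ i ∈ s, Y i w) z = fun u => ∑ i ∈ s, localParam (Y i) z u := rfl
  have h3 : ∀ (A : 𝔼 m →L[ℝ] 𝔼 n) (B : ι → 𝔼 m →L[ℝ] 𝔼 n),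
      tangentialTrace A (∑ i ∈ s, B i) = ∑ i ∈ s, tangentialTrace A (B i) := by
    intro A B
    classical
    induction s using Finset.induction_on with
    | empty => simp [tangentialTrace_zero]
    | insert a s ha ih =>
      rw [Finset.sum_insert ha, Finset.sum_insert ha, tangentialTrace_add,
        ih (fun i hi => hY i (Finset.mem_insert_of_mem hi)) (fun i hi => h i (Finset.mem_insert_of_mem hi)) rfl]
  rw [tangentialDiv, h2, fderiv_fun_sum h, h3]
  rfl

namespace IsProperMinimalImmersion

variable (hF : IsProperMinimalImmersion m F)

include hF

theorem contMDiff_one : ContMDiff (𝓡 m) (𝓡 n) 1 F := hF.contMDiff.of_le (by simp)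

theorem contDiffAt {x z : M} (hz : z ∈ (chartAt (𝔼 m) x).source) :
    ContDiffAt ℝ ∞ (localParam F x) (chartAt (𝔼 m) x z) :=
  contDiffAt_localParam le_rfl hF.contMDiff hz

theorem continuousOn_areaJacobian (x : M) :
    ContinuousOn (areaJacobian (localParam F x)) (chartAt (𝔼 m) x).target := by
  intro u hu
  have hz := (chartAt (𝔼 m) x).map_target hu
  have h1 := hF.contDiffAt hz
  have h2 := hF.injective_fderiv hz
  rw [(chartAt (𝔼 m) x).right_inv hu] at h1 h2
  exact (contDiffAt_areaJacobian h1 h2).continuousAt.continuousWithinAt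

theorem continuous_tangentialDiv {Y : M → 𝔼 n} (hY : ContMDiff (𝓡 m) (𝓡 n) 1 Y) :
    Continuous (tangentialDiv m F Y) := by
  rw [continuous_iff_continuousAt]
  intro z
  have hz := mem_chart_source (𝔼 m) z
  have h := continuousAt_tangentialTrace (hF.contDiffAt hz) (hF.injective_fderiv hz)
    (contDiffAt_localParam (by simp) hY hz)
  refine (ContinuousAt.comp (f := chartAt (𝔼 m) z) h ((chartAt (𝔼 m) z).continuousAt hz)).congr ?_
  filter_upwards [(chartAt (𝔼 m) z).open_source.mem_nhds hz] with w hw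
  rw [tangentialDiv_eq hF.contMDiff_one hY hw]
  rfl

variable [MeasurableSpace M] [BorelSpace M] [SecondCountableTopology M] [Nonempty M]

theorem isLocallyFiniteMeasure : IsLocallyFiniteMeasure (areaMeasure m F) :=
  isLocallyFiniteMeasure_areaMeasure hF.contMDiff_one hF.continuousOn_areaJacobian

theorem integral_tangentialDiv_of_subset_source [T2Space M] {Y : M → 𝔼 n}
    (hY : ContMDiff (𝓡 m) (𝓡 n) 1 Y) (hc : HasCompactSupport Y) {x : M}
    (hx : tsupport Y ⊆ (chartAt (𝔼 m) x).source) :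
    ∫ z, tangentialDiv m F Y z ∂(areaMeasure m F) = 0 := by
  set c := chartAt (𝔼 m) x with hcdef
  have htarget : ∀ u ∈ c.target, ∃ z ∈ c.source, c z = u := fun u hu =>
    ⟨c.symm u, c.map_target hu, c.right_inv hu⟩
  let K := c '' tsupport Y
  have hK : IsCompact K := hc.isCompact.image_of_continuousOn (c.continuousOn.mono hx)
  have hKt : K ⊆ c.target := by
    rintro _ ⟨z, hz, rfl⟩
    exact c.map_source (hx hz)
  -- Extension by zero of `Y` read in the chart. It is `C¹` on all of `ℝᵐ` because the image `K` of
  -- the support is compact inside the open target.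
  let Z : 𝔼 m → 𝔼 n := c.target.indicator (localParam Y x)
  have hZt : ∀ u ∈ c.target, Z =ᶠ[𝓝 u] localParam Y x := fun u hu => by
    filter_upwards [c.open_target.mem_nhds hu] with v hv
    exact indicator_of_mem hv _
  have hZ0 : ∀ u, u ∉ K → Z u = 0 := by
    intro u hu
    by_cases hut : u ∈ c.target
    · refine (indicator_of_mem hut _).trans ?_
      have h0 : Y (c.symm u) = 0 :=
        image_eq_zero_of_notMem_tsupport fun h => hu ⟨_, h, c.right_inv hut⟩
      exact h0
    · exact indicator_of_notMem hut _
  have hZK : ∀ u, u ∉ K → Z =ᶠ[𝓝 u] fun _ => (0 : 𝔼 n) := fun u hu =>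
    (hK.isClosed.isOpen_compl.mem_nhds hu : Kᶜ ∈ 𝓝 u) |> fun h => by
      filter_upwards [h] with v hv using hZ0 v hv
  have hZC : ContDiff ℝ 1 Z := contDiff_iff_contDiffAt.2 fun u => by
    by_cases hu : u ∈ K
    · obtain ⟨z, hz, rfl⟩ := htarget u (hKt hu)
      exact (contDiffAt_localParam (by simp) hY hz).congr_of_eventuallyEq (hZt _ (hKt hu))
    · exact contDiffAt_const.congr_of_eventuallyEq (hZK u hu)
  have hZs : tsupport Z ⊆ K := by
    refine closure_minimal (fun u hu => ?_) hK.isClosed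
    by_contra h
    exact hu (hZ0 u h)
  have hmain := integral_tangentialTrace_param (φ := localParam F x) c.open_target
    (contDiffOn_localParam le_rfl hF.contMDiff x)
    (fun u hu => by
      obtain ⟨z, hz, rfl⟩ := htarget u hu
      exact hF.injective_fderiv hz)
    (fun u hu => by
      obtain ⟨z, hz, rfl⟩ := htarget u hu
      exact hF.paramMeanCurvature_eq_zero hz)
    hZC (HasCompactSupport.intro hK hZ0) (hZs.trans hKt)
  rw [← setIntegral_eq_integral_of_forall_compl_eq_zero (s := c.target)] at hmain
  · rw [integral_areaMeasure hF.contMDiff_one hF.continuousOn_areaJacobian (x := x)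
      (hF.continuous_tangentialDiv hY) fun z hz => tangentialDiv_eq_zero F fun h => hz (hx h), ← hmain]
    refine setIntegral_congr_fun c.open_target.measurableSet fun u hu => ?_
    obtain ⟨z, hz, rfl⟩ := htarget u hu
    rw [← hcdef, c.left_inv hz, tangentialDiv_eq hF.contMDiff_one hY hz, (hZt _ hu).fderiv_eq]
  · intro u hu
    rw [(hZK u fun h => hu (hKt h)).fderiv_eq]
    simp [tangentialTrace]

/-- The first variation formula. -/
theorem integral_tangentialDiv [T2Space M] {Y : M → 𝔼 n}
    (hY : ContMDiff (𝓡 m) (𝓡 n) 1 Y) (hc : HasCompactSupport Y) :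
    ∫ z, tangentialDiv m F Y z ∂(areaMeasure m F) = 0 := by
  have := hF.isLocallyFiniteMeasure
  have : LocallyCompactSpace M := ChartedSpace.locallyCompactSpace (𝔼 m) M
  obtain ⟨ρ, hρ⟩ := SmoothPartitionOfUnity.exists_isSubordinate_chartAt_source (𝓡 m) M
  -- By local finiteness only finitely many members of the partition meet the compact support, so
  -- `Y` is a finite sum of fields each supported in one chart.
  have hfin : {i | (Function.support (ρ i) ∩ tsupport Y).Nonempty}.Finite :=
    ρ.locallyFinite.finite_nonempty_inter_compact hc.isCompact
  obtain ⟨s, hs⟩ : ∃ s : Finset M, ∀ i, i ∈ s ↔ (Function.support (ρ i) ∩ tsupport Y).Nonempty :=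
    ⟨hfin.toFinset, fun i => by simp⟩
  have hρ1 : ∀ i, ContMDiff (𝓡 m) 𝓘(ℝ, ℝ) 1 (ρ i) := fun i => (ρ i).contMDiff.of_le (by simp)
  have hYi : ∀ i, ContMDiff (𝓡 m) (𝓡 n) 1 fun z => ρ i z • Y z := fun i => (hρ1 i).smul hY
  have hci : ∀ i, HasCompactSupport fun z => ρ i z • Y z := fun i =>
    hc.mono fun z hz h => hz (by simp only [h, smul_zero])
  have hsum : Y = fun z => ∑ i ∈ s, ρ i z • Y z := by
    ext1 z
    by_cases hz : z ∈ tsupport Y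
    · rw [← Finset.sum_smul, ρ.sum_finsupport' z (mem_univ z), one_smul]
      intro i hi
      rw [SmoothPartitionOfUnity.mem_finsupport] at hi
      exact (hs i).2 ⟨z, hi, hz⟩
    · simp [image_eq_zero_of_notMem_tsupport hz]
  have h1 : tangentialDiv m F Y = fun z => ∑ i ∈ s, tangentialDiv m F (fun z => ρ i z • Y z) z := by
    ext1 z
    conv_lhs => rw [hsum]
    exact tangentialDiv_sum F s (fun i _ => hYi i) z
  have h2 : ∀ i ∈ s, Integrable (tangentialDiv m F fun z => ρ i z • Y z) (areaMeasure m F) := fun i _ =>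
    (hF.continuous_tangentialDiv (hYi i)).integrable_of_hasCompactSupport
      (HasCompactSupport.intro (hci i).isCompact fun z hz => tangentialDiv_eq_zero F hz)
  rw [h1, integral_finsetSum s h2]
  refine Finset.sum_eq_zero fun i _ => ?_
  have h3 : tsupport (fun z => ρ i z • Y z) ⊆ (chartAt (𝔼 m) i).source :=
    (tsupport_smul_subset_left (ρ i) Y).trans (hρ i)
  exact hF.integral_tangentialDiv_of_subset_source (hYi i) (hci i) h3

end IsProperMinimalImmersion

end Manifold

/-! ### Cutoff profiles -/

/-- A nonincreasing `C¹` cutoff function of the squared radius, vanishing from radius `1` on. -/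
structure IsProfile (χ : ℝ → ℝ) : Prop where
  contDiff : ContDiff ℝ 1 χ
  eq_zero : ∀ s, 1 ≤ s → χ s = 0
  deriv_nonpos : ∀ s, 0 ≤ s → deriv χ s ≤ 0

theorem IsProfile.hasDerivAt {χ : ℝ → ℝ} (hχ : IsProfile χ) (s : ℝ) : HasDerivAt χ (deriv χ s) s :=
  (hχ.contDiff.differentiable one_ne_zero s).hasDerivAt

theorem IsProfile.continuous_deriv {χ : ℝ → ℝ} (hχ : IsProfile χ) : Continuous (deriv χ) :=
  hχ.contDiff.continuous_deriv le_rfl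

theorem IsProfile.deriv_eq_zero {χ : ℝ → ℝ} (hχ : IsProfile χ) {s : ℝ} (hs : 1 < s) : deriv χ s = 0 := by
  have : χ =ᶠ[𝓝 s] fun _ => 0 := by
    filter_upwards [lt_mem_nhds hs] with r hr using hχ.eq_zero r hr.le
  rw [this.deriv_eq, deriv_const]

theorem hasDerivAt_max_zero_sq (x : ℝ) : HasDerivAt (fun y : ℝ => max y 0 ^ 2) (2 * max x 0) x := by
  rcases lt_trichotomy x 0 with hx | rfl | hx
  · have : (fun y : ℝ => max y 0 ^ 2) =ᶠ[𝓝 x] fun _ => 0 := by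
      filter_upwards [gt_mem_nhds hx] with y hy
      simp [max_eq_right hy.le]
    rw [max_eq_right hx.le, mul_zero]
    exact (hasDerivAt_const x (0 : ℝ)).congr_of_eventuallyEq this
  · rw [← hasDerivWithinAt_univ, ← Iic_union_Ici (a := (0 : ℝ))]
    refine HasDerivWithinAt.union ?_ ?_
    · refine ((hasDerivWithinAt_const (0 : ℝ) (Iic 0) (0 : ℝ)).congr (fun y hy => ?_) (by simp)).congr_deriv
        (by simp)
      simp [max_eq_right (mem_Iic.1 hy)]
    · refine ((hasDerivAt_pow 2 (0 : ℝ)).hasDerivWithinAt.congr (fun y hy => ?_) (by simp)).congr_deriv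
        (by simp)
      simp [max_eq_left (mem_Ici.1 hy)]
  · have : (fun y : ℝ => max y 0 ^ 2) =ᶠ[𝓝 x] fun y => y ^ 2 := by
      filter_upwards [lt_mem_nhds hx] with y hy
      rw [max_eq_left hy.le]
    rw [max_eq_left hx.le]
    exact ((hasDerivAt_pow 2 x).congr_of_eventuallyEq this).congr_deriv (by simp)

/-- The profiles `1 - (1 - (1 - s)₊²)ᵏ`, which increase to the indicator function of `[0, 1)`. -/
noncomputable def approxProfile (k : ℕ) (s : ℝ) : ℝ := 1 - (1 - max (1 - s) 0 ^ 2) ^ k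

theorem hasDerivAt_approxProfile (k : ℕ) (s : ℝ) : HasDerivAt (approxProfile k)
    (-(k * (1 - max (1 - s) 0 ^ 2) ^ (k - 1) * (2 * max (1 - s) 0))) s := by
  have h1 : HasDerivAt (fun s : ℝ => max (1 - s) 0 ^ 2) (2 * max (1 - s) 0 * -1) s :=
    (hasDerivAt_max_zero_sq (1 - s)).comp s ((hasDerivAt_id s).const_sub 1)
  exact (((h1.const_sub 1).pow k).const_sub 1).congr_deriv (by simp)

theorem max_one_sub_mem {s : ℝ} (hs : 0 ≤ s) : 0 ≤ 1 - max (1 - s) 0 ^ 2 ∧ 1 - max (1 - s) 0 ^ 2 ≤ 1 := by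
  have h0 : 0 ≤ max (1 - s) 0 := le_max_right _ _
  have h1 : max (1 - s) 0 ≤ 1 := max_le (by linarith) zero_le_one
  constructor <;> nlinarith

/-- Squaring the positive part is what makes the profile `C¹` at `s = 1`. The sign of the derivative
needs `s ≥ 0`, where the base of the power is nonnegative. -/
theorem isProfile_approxProfile (k : ℕ) : IsProfile (approxProfile k) where
  contDiff := by
    refine contDiff_one_iff_deriv.2 ⟨fun s => (hasDerivAt_approxProfile k s).differentiableAt, ?_⟩
    rw [funext fun s => (hasDerivAt_approxProfile k s).deriv]
    fun_prop
  eq_zero s hs := by simp [approxProfile, max_eq_right (sub_nonpos.2 hs)]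
  deriv_nonpos s hs := by
    rw [(hasDerivAt_approxProfile k s).deriv, neg_nonpos]
    have := (max_one_sub_mem hs).1
    positivity

theorem abs_approxProfile_le (k : ℕ) {s : ℝ} (hs : 0 ≤ s) : |approxProfile k s| ≤ 1 := by
  obtain ⟨h1, h2⟩ := max_one_sub_mem hs
  have h3 := pow_le_one₀ (n := k) h1 h2
  have h4 := pow_nonneg h1 k
  rw [approxProfile, abs_le]
  constructor <;> linarith

theorem tendsto_approxProfile {s : ℝ} (hs : 0 ≤ s) :
    Tendsto (fun k => approxProfile k s) atTop (𝓝 (if s < 1 then 1 else 0)) := by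
  split_ifs with h
  · have h1 : 0 < max (1 - s) 0 := lt_max_of_lt_left (by linarith)
    have := tendsto_pow_atTop_nhds_zero_of_lt_one (max_one_sub_mem hs).1
      (by nlinarith : 1 - max (1 - s) 0 ^ 2 < 1)
    simpa [approxProfile] using this.const_sub 1
  · simp [(isProfile_approxProfile _).eq_zero s (not_lt.1 h)]

/-- Confines the supports of radial cutoffs to compact preimages of balls. The slack `s ≤ t` gives
one compact set for all parameters near a given one. -/
theorem mem_preimage_closedBall_of_mul_sq_le {M : Type*} {F : M → 𝔼 n} (p : 𝔼 n) {t s : ℝ} (hs : 0 < s) (hst : s ≤ t) {z : M} (hz : t ^ 2 * ‖F z - p‖ ^ 2 ≤ 1) :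
    z ∈ F ⁻¹' Metric.closedBall p s⁻¹ := by
  rw [mem_preimage, mem_closedBall_iff_norm, ← one_div, le_div_iff₀ hs]
  have h1 : t * ‖F z - p‖ ≤ 1 := by
    rw [← mul_pow] at hz
    exact (sq_le_one_iff₀ (mul_nonneg (hs.le.trans hst) (norm_nonneg _))).1 hz
  nlinarith [norm_nonneg (F z - p)]

/-! ### The monotonicity formula -/

section Manifold

variable {M : Type*} [TopologicalSpace M] [ChartedSpace (𝔼 m) M]
  [IsManifold (𝓡 m) ∞ M] {F : M → 𝔼 n}

/-- The squared norm of the tangential component of `F - p`. -/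
noncomputable def tangentialPart (m : ℕ) {n : ℕ} {M : Type*} [TopologicalSpace M] [ChartedSpace (𝔼 m) M]
    (F : M → 𝔼 n) (p : 𝔼 n) (z : M) : ℝ :=
  tangentialSq (fderiv ℝ (localParam F z) (chartAt (𝔼 m) z z)) (F z - p)

namespace IsProperMinimalImmersion

variable (hF : IsProperMinimalImmersion m F) {χ : ℝ → ℝ} (hχ : IsProfile χ) (p : 𝔼 n) {t : ℝ}

include hF

theorem continuous : Continuous F := hF.contMDiff.continuous

theorem tangentialPart_le (z : M) : tangentialPart m F p z ≤ ‖F z - p‖ ^ 2 :=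
  tangentialSq_le (hF.injective_fderiv (mem_chart_source _ z)) _

theorem contMDiff_radial (hχ : IsProfile χ) (t : ℝ) :
    ContMDiff (𝓡 m) (𝓡 n) 1 fun z => χ (t ^ 2 * ‖F z - p‖ ^ 2) • (F z - p) := by
  have h : ContDiff ℝ 1 fun y : 𝔼 n => χ (t ^ 2 * ‖y - p‖ ^ 2) • (y - p) :=
    (hχ.contDiff.comp (contDiff_const.mul ((contDiff_id.sub contDiff_const).norm_sq ℝ))).smul
      (contDiff_id.sub contDiff_const)
  exact h.contMDiff.comp hF.contMDiff_one

theorem tangentialDiv_radial (hχ : IsProfile χ) (t : ℝ) (z : M) :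
    tangentialDiv m F (fun z => χ (t ^ 2 * ‖F z - p‖ ^ 2) • (F z - p)) z =
      χ (t ^ 2 * ‖F z - p‖ ^ 2) * m +
        2 * t ^ 2 * deriv χ (t ^ 2 * ‖F z - p‖ ^ 2) * tangentialPart m F p z := by
  have hz := mem_chart_source (𝔼 m) z
  set A := fderiv ℝ (localParam F z) (chartAt (𝔼 m) z z) with hA
  have h1 : HasFDerivAt (fun u => localParam F z u - p) A (chartAt (𝔼 m) z z) :=
    ((hF.contDiffAt hz).differentiableAt (by simp)).hasFDerivAt.sub_const p
  have h2 : localParam F z (chartAt (𝔼 m) z z) = F z := localParam_chartAt F hz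
  have h3 := ((hχ.hasDerivAt _).comp_hasFDerivAt _ (h1.norm_sq.const_mul (t ^ 2))).smul h1
  rw [tangentialDiv, tangentialPart, ← hA, ← tangentialTrace_radial (hF.injective_fderiv hz)]
  congr 1
  refine Eq.trans h3.fderiv ?_
  rw [h2]
  ext1 v
  simp only [Function.comp_apply, h2, _root_.add_apply, _root_.smul_apply,
    ContinuousLinearMap.smulRight_apply, ContinuousLinearMap.comp_apply, smul_smul, smul_eq_mul, nsmul_eq_mul]
  congr 2
  push_cast
  ring

theorem isCompact_preimage (r : ℝ) : IsCompact (F ⁻¹' Metric.closedBall p r) :=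
  hF.proper.isCompact_preimage (isCompact_closedBall p r)

theorem hasCompactSupport_of_eq_zero {G : Type*} [Zero G] {f : M → G} (ht : 0 < t) [T2Space M]
    (hf : ∀ z, 1 < t ^ 2 * ‖F z - p‖ ^ 2 → f z = 0) : HasCompactSupport f :=
  HasCompactSupport.intro (hF.isCompact_preimage p t⁻¹) fun z hz => hf z <| by
    by_contra h
    exact hz (mem_preimage_closedBall_of_mul_sq_le p ht le_rfl (not_lt.1 h))

variable [MeasurableSpace M] [BorelSpace M] [SecondCountableTopology M] [Nonempty M] [T2Space M]

theorem integrable_of_eq_zero {f : M → ℝ} (hc : Continuous f) (ht : 0 < t)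
    (hf : ∀ z, 1 < t ^ 2 * ‖F z - p‖ ^ 2 → f z = 0) : Integrable f (areaMeasure m F) :=
  have := hF.isLocallyFiniteMeasure
  hc.integrable_of_hasCompactSupport (hF.hasCompactSupport_of_eq_zero p ht hf)

theorem integral_radial (hχ : IsProfile χ) (ht : 0 < t) :
    ∫ z, (χ (t ^ 2 * ‖F z - p‖ ^ 2) * m +
        2 * t ^ 2 * deriv χ (t ^ 2 * ‖F z - p‖ ^ 2) * tangentialPart m F p z) ∂(areaMeasure m F) = 0 := by
  simp only [← hF.tangentialDiv_radial p hχ]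
  refine hF.integral_tangentialDiv (hF.contMDiff_radial p hχ t) (hF.hasCompactSupport_of_eq_zero p ht ?_)
  intro z hz
  rw [hχ.eq_zero _ hz.le, zero_smul]

/-- Continuity comes from writing the defect as the divergence of a `C¹` field minus an explicit
continuous function of `F`, so the tangential part need not be treated on its own. -/
theorem continuous_radial_defect (hχ : IsProfile χ) : Continuous fun z =>
    2 * t ^ 2 * deriv χ (t ^ 2 * ‖F z - p‖ ^ 2) * (tangentialPart m F p z - ‖F z - p‖ ^ 2) := by
  have h1 := hF.continuous_tangentialDiv (hF.contMDiff_radial p hχ t)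
  have hc := hF.continuous
  have hd := hχ.continuous_deriv
  have hχc := hχ.contDiff.continuous
  have h2 : Continuous fun z => χ (t ^ 2 * ‖F z - p‖ ^ 2) * m +
      2 * t ^ 2 * deriv χ (t ^ 2 * ‖F z - p‖ ^ 2) * ‖F z - p‖ ^ 2 := by fun_prop
  refine (h1.sub h2).congr fun z => ?_
  rw [Pi.sub_apply, hF.tangentialDiv_radial p hχ]
  ring

theorem radial_defect_nonneg (hχ : IsProfile χ) (z : M) :
    0 ≤ 2 * t ^ 2 * deriv χ (t ^ 2 * ‖F z - p‖ ^ 2) * (tangentialPart m F p z - ‖F z - p‖ ^ 2) := by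
  have h1 := hF.tangentialPart_le p z
  have h2 := hχ.deriv_nonpos (t ^ 2 * ‖F z - p‖ ^ 2) (by positivity)
  exact mul_nonneg_of_nonpos_of_nonpos (mul_nonpos_of_nonneg_of_nonpos (by positivity) h2) (by linarith)

/-- The first variation with `|F - p|²` in place of its tangential part: the left side arises on
differentiating `tᵐ ∫ χ`, and the integral on the right is nonnegative. -/
theorem integral_profile_eq (hχ : IsProfile χ) (ht : 0 < t) :
    ∫ z, (χ (t ^ 2 * ‖F z - p‖ ^ 2) * m +
        2 * t ^ 2 * deriv χ (t ^ 2 * ‖F z - p‖ ^ 2) * ‖F z - p‖ ^ 2) ∂(areaMeasure m F) =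
      -∫ z, 2 * t ^ 2 * deriv χ (t ^ 2 * ‖F z - p‖ ^ 2) *
        (tangentialPart m F p z - ‖F z - p‖ ^ 2) ∂(areaMeasure m F) := by
  have hc := hF.continuous
  have hd := hχ.continuous_deriv
  have hχc := hχ.contDiff.continuous
  rw [eq_neg_iff_add_eq_zero, ← integral_add, ← hF.integral_radial p hχ ht]
  · congr 1; ext z; ring
  · refine hF.integrable_of_eq_zero p (by fun_prop) ht fun z hz => ?_
    rw [hχ.eq_zero _ hz.le, hχ.deriv_eq_zero hz]; ring
  · refine hF.integrable_of_eq_zero p (hF.continuous_radial_defect p hχ) ht fun z hz => ?_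
    rw [hχ.deriv_eq_zero hz]; ring

theorem hasDerivAt_integral_profile (hχ : IsProfile χ) (ht : 0 < t) :
    HasDerivAt (fun s : ℝ => ∫ z, χ (s ^ 2 * ‖F z - p‖ ^ 2) ∂(areaMeasure m F))
      (∫ z, deriv χ (t ^ 2 * ‖F z - p‖ ^ 2) * (2 * t * ‖F z - p‖ ^ 2) ∂(areaMeasure m F)) t := by
  have hc := hF.continuous
  have hd := hχ.continuous_deriv
  have hχc := hχ.contDiff.continuous
  have := hF.isLocallyFiniteMeasure
  obtain ⟨C, hC⟩ := (isCompact_Icc (a := (0 : ℝ)) (b := 1)).exists_bound_of_continuousOn hd.continuousOn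
  have hC0 : 0 ≤ C := (norm_nonneg _).trans (hC 0 (by simp))
  -- For every `s > t/2` the integrand vanishes off this compact set. On it, for `s < 2t`, the
  -- dominating constant uses `|χ'| ≤ C` on `[0, 1]`, `2s ≤ 2(2t)` and `|F - p| ≤ (t/2)⁻¹`.
  set K := F ⁻¹' Metric.closedBall p (t / 2)⁻¹ with hK
  have hKm : MeasurableSet K := (Metric.isClosed_closedBall.preimage hc).measurableSet
  refine (hasDerivAt_integral_of_dominated_loc_of_deriv_le (s := Ioo (t / 2) (2 * t))
    (F := fun s z => χ (s ^ 2 * ‖F z - p‖ ^ 2))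
    (F' := fun s z => deriv χ (s ^ 2 * ‖F z - p‖ ^ 2) * (2 * s * ‖F z - p‖ ^ 2))
    (bound := K.indicator fun _ => C * (2 * (2 * t) * ((t / 2)⁻¹) ^ 2))
    (Ioo_mem_nhds (by linarith) (by linarith)) ?_ ?_ ?_ ?_ ?_ ?_).2
  · exact Eventually.of_forall fun s => (by fun_prop : Continuous _).aestronglyMeasurable
  · exact hF.integrable_of_eq_zero p (by fun_prop) ht fun z hz => hχ.eq_zero _ hz.le
  · exact (by fun_prop : Continuous _).aestronglyMeasurable
  · refine Eventually.of_forall fun z s hs => ?_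
    have hs0 : 0 < s := by linarith [hs.1]
    by_cases hz : 1 < s ^ 2 * ‖F z - p‖ ^ 2
    · rw [hχ.deriv_eq_zero hz, zero_mul, norm_zero]
      exact indicator_nonneg (fun _ _ => by positivity) _
    · have hzK : z ∈ K := mem_preimage_closedBall_of_mul_sq_le p (half_pos ht) hs.1.le (not_lt.1 hz)
      have hzn : ‖F z - p‖ ≤ (t / 2)⁻¹ := by simpa [hK, dist_eq_norm] using hzK
      rw [indicator_of_mem hzK, norm_mul]
      refine mul_le_mul (hC _ ⟨by positivity, not_lt.1 hz⟩) ?_ (norm_nonneg _) hC0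
      rw [Real.norm_of_nonneg (by positivity)]
      have := hs.2.le
      gcongr
  · exact (integrable_indicator_iff hKm).2
      (integrableOn_const (hs := (hF.isCompact_preimage p _).measure_lt_top.ne))
  · refine Eventually.of_forall fun z s _ => ?_
    refine ((hχ.hasDerivAt _).comp s ((hasDerivAt_pow 2 s).mul_const _)).congr_deriv ?_
    simp

/-- The derivative of `t ↦ tᵐ ∫ χ(t²|F - p|²)`. -/
theorem hasDerivAt_pow_mul_integral_profile (hχ : IsProfile χ) (ht : 0 < t) :
    HasDerivAt (fun s : ℝ => s ^ m * ∫ z, χ (s ^ 2 * ‖F z - p‖ ^ 2) ∂(areaMeasure m F))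
      (-(t ^ m / t * ∫ z, 2 * t ^ 2 * deriv χ (t ^ 2 * ‖F z - p‖ ^ 2) *
        (tangentialPart m F p z - ‖F z - p‖ ^ 2) ∂(areaMeasure m F))) t := by
  have hc := hF.continuous
  have hd := hχ.continuous_deriv
  have hχc := hχ.contDiff.continuous
  refine ((hasDerivAt_pow m t).mul (hF.hasDerivAt_integral_profile p hχ ht)).congr_deriv ?_
  rw [← mul_neg, ← hF.integral_profile_eq p hχ ht, integral_add, integral_mul_const]
  · have h1 : ∫ z, 2 * t ^ 2 * deriv χ (t ^ 2 * ‖F z - p‖ ^ 2) * ‖F z - p‖ ^ 2 ∂(areaMeasure m F) =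
        t * ∫ z, deriv χ (t ^ 2 * ‖F z - p‖ ^ 2) * (2 * t * ‖F z - p‖ ^ 2) ∂(areaMeasure m F) := by
      rw [← integral_const_mul]
      congr 1; ext z; ring
    rw [h1]
    generalize ∫ z, deriv χ (t ^ 2 * ‖F z - p‖ ^ 2) * (2 * t * ‖F z - p‖ ^ 2) ∂(areaMeasure m F) = b
    generalize ∫ z, χ (t ^ 2 * ‖F z - p‖ ^ 2) ∂(areaMeasure m F) = a
    -- Writing `tᵐ / t` keeps the formula valid for `m = 0`, where the truncated exponent `m - 1` is
    -- `0`.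
    have h2 : (m : ℝ) * t ^ (m - 1) = m * (t ^ m / t) := by
      rcases Nat.eq_zero_or_pos m with h | h
      · simp [h]
      · rw [← pow_sub_one_mul h.ne', mul_div_cancel_right₀ _ ht.ne']
    rw [h2]
    field_simp
  · exact hF.integrable_of_eq_zero p (by fun_prop) ht fun z hz => by rw [hχ.eq_zero _ hz.le, zero_mul]
  · exact hF.integrable_of_eq_zero p (by fun_prop) ht fun z hz => by rw [hχ.deriv_eq_zero hz]; ring

theorem antitoneOn_pow_mul_integral_profile (hχ : IsProfile χ) :
    AntitoneOn (fun s : ℝ => s ^ m * ∫ z, χ (s ^ 2 * ‖F z - p‖ ^ 2) ∂(areaMeasure m F)) (Ioi 0) := by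
  refine antitoneOn_of_deriv_nonpos (convex_Ioi 0) (fun t ht =>
    (hF.hasDerivAt_pow_mul_integral_profile p hχ ht).continuousAt.continuousWithinAt) ?_ ?_
  · rw [interior_Ioi]
    exact fun t ht =>
      (hF.hasDerivAt_pow_mul_integral_profile p hχ ht).differentiableAt.differentiableWithinAt
  · rw [interior_Ioi]
    intro t ht
    rw [(hF.hasDerivAt_pow_mul_integral_profile p hχ ht).deriv, neg_nonpos]
    have ht' : 0 < t := ht
    exact mul_nonneg (by positivity) (integral_nonneg fun z => hF.radial_defect_nonneg p hχ z)

/-- Dominated convergence: the profiles are bounded by `1`, supported in one compact set, and tend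
to the indicator of `t|F - p| < 1`. -/
theorem tendsto_integral_approxProfile (ht : 0 < t) :
    Tendsto (fun k => ∫ z, approxProfile k (t ^ 2 * ‖F z - p‖ ^ 2) ∂(areaMeasure m F)) atTop
      (𝓝 ((areaMeasure m F).real (F ⁻¹' Metric.ball p t⁻¹))) := by
  have hc := hF.continuous
  have := hF.isLocallyFiniteMeasure
  set K := F ⁻¹' Metric.closedBall p t⁻¹ with hK
  have hKm : MeasurableSet K := (Metric.isClosed_closedBall.preimage hc).measurableSet
  have hBm : MeasurableSet (F ⁻¹' Metric.ball p t⁻¹) := (Metric.isOpen_ball.preimage hc).measurableSet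
  rw [← integral_indicator_one hBm]
  refine tendsto_integral_of_dominated_convergence (K.indicator fun _ => 1) (fun k => ?_) ?_ (fun k => ?_) ?_
  · have hχc := (isProfile_approxProfile k).contDiff.continuous
    exact (by fun_prop : Continuous _).aestronglyMeasurable
  · exact (integrable_indicator_iff hKm).2
      (integrableOn_const (hs := (hF.isCompact_preimage p _).measure_lt_top.ne))
  · refine Eventually.of_forall fun z => ?_
    by_cases hz : 1 < t ^ 2 * ‖F z - p‖ ^ 2
    · rw [(isProfile_approxProfile k).eq_zero _ hz.le, norm_zero]
      exact indicator_nonneg (fun _ _ => by positivity) _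
    · rw [indicator_of_mem (mem_preimage_closedBall_of_mul_sq_le p ht le_rfl (not_lt.1 hz))]
      exact abs_approxProfile_le k (by positivity)
  · refine Eventually.of_forall fun z => ?_
    have h := tendsto_approxProfile (s := t ^ 2 * ‖F z - p‖ ^ 2) (by positivity)
    have h2 : t ^ 2 * ‖F z - p‖ ^ 2 < 1 ↔ z ∈ F ⁻¹' Metric.ball p t⁻¹ := by
      rw [mem_preimage, mem_ball_iff_norm, ← mul_pow, sq_lt_one_iff₀ (by positivity), ← one_div, lt_div_iff₀ ht,
        mul_comm]
    convert h using 2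
    by_cases hz : z ∈ F ⁻¹' Metric.ball p t⁻¹
    · rw [indicator_of_mem hz, if_pos (h2.2 hz), Pi.one_apply]
    · rw [indicator_of_notMem hz, if_neg (mt h2.1 hz)]

/-- The monotonicity formula. -/
theorem monotoneOn_area_div_pow :
    MonotoneOn (fun r : ℝ => (areaMeasure m F).real (F ⁻¹' Metric.ball p r) / r ^ m) (Ioi 0) := by
  intro r hr s hs hrs
  have hr' : 0 < r := hr
  have hs' : 0 < s := hs
  have h1 := (hF.tendsto_integral_approxProfile p (inv_pos.2 hr')).const_mul (r⁻¹ ^ m)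
  have h2 := (hF.tendsto_integral_approxProfile p (inv_pos.2 hs')).const_mul (s⁻¹ ^ m)
  have h3 := le_of_tendsto_of_tendsto' h1 h2 fun k =>
    hF.antitoneOn_pow_mul_integral_profile p (isProfile_approxProfile k) (inv_pos.2 hs') (inv_pos.2 hr')
      (inv_anti₀ hr' hrs)
  simpa [div_eq_inv_mul] using h3

end IsProperMinimalImmersion

end Manifold

/-! ### Lower density at small scales -/

theorem exists_pos_mul_norm_le {A : 𝔼 m →L[ℝ] 𝔼 n} (hA : Function.Injective A) :
    ∃ κ > 0, ∀ w, κ * ‖w‖ ≤ ‖A w‖ := by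
  obtain ⟨K, hK, h⟩ := (A : 𝔼 m →ₗ[ℝ] 𝔼 n).exists_antilipschitzWith (LinearMap.ker_eq_bot.2 hA)
  have hK' : (0 : ℝ) < K := hK
  refine ⟨(K : ℝ)⁻¹, inv_pos.2 hK', fun w => ?_⟩
  have h1 := h.le_mul_dist w 0
  simp only [map_zero, dist_zero_right] at h1
  rw [inv_mul_le_iff₀ hK']
  exact h1

section Manifold

variable {M : Type*} [TopologicalSpace M] [ChartedSpace (𝔼 m) M]
  [IsManifold (𝓡 m) ∞ M] {F : M → 𝔼 n}

namespace IsProperMinimalImmersion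

variable (hF : IsProperMinimalImmersion m F)

variable [MeasurableSpace M] [BorelSpace M] [SecondCountableTopology M] [Nonempty M]

include hF

/-- Near `u₀` distances grow by at most `1 + δ` relative to the differential `A`, and the Jacobian
drops by at most the factor `1 - δ`. The ellipsoid `|A(u - u₀)| < r/(1 + δ)` therefore maps into the
ball of radius `r` and has area at least `(1 - δ)(1 + δ)⁻ᵐ ω_m rᵐ`. The neighbourhood `N` allows
distinct sheets to be counted separately. -/
theorem eventually_le_area (x : M) {N : Set M} (hN : N ∈ 𝓝 x) {a : ℝ} (ha : a < 1) :
    ∀ᶠ r in 𝓝[>] (0 : ℝ), ENNReal.ofReal a * (volume (Metric.ball (0 : 𝔼 m) 1) * ENNReal.ofReal (r ^ m)) ≤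
      areaMeasure m F (F ⁻¹' Metric.ball (F x) r ∩ N) := by
  set c := chartAt (𝔼 m) x with hc
  have hx : x ∈ c.source := mem_chart_source (𝔼 m) x
  set φ := localParam (m := m) F x with hφdef
  set u₀ := c x with hu₀
  have hφ : ContDiffAt ℝ ∞ φ u₀ := hF.contDiffAt hx
  have hi : Function.Injective (fderiv ℝ φ u₀) := hF.injective_fderiv hx
  set A := fderiv ℝ φ u₀ with hA
  have hJ₀ : 0 < areaJacobian φ u₀ := areaJacobian_pos hi
  obtain ⟨κ, hκ, hκA⟩ := exists_pos_mul_norm_le hi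
  obtain ⟨δ, ⟨hδ0, hδ1⟩, hδ⟩ : ∃ δ ∈ Ioo (0 : ℝ) 1, a < (1 - δ) * ((1 + δ)⁻¹) ^ m := by
    have h1 : ContinuousAt (fun δ : ℝ => (1 - δ) * ((1 + δ)⁻¹) ^ m) 0 := by
      refine ContinuousAt.mul (by fun_prop) (ContinuousAt.pow (ContinuousAt.inv₀ (by fun_prop) (by simp)) _)
    have h2 : ∀ᶠ δ in 𝓝 (0 : ℝ), a < (1 - δ) * ((1 + δ)⁻¹) ^ m := h1.eventually_const_lt (by simpa using ha)
    have h3 : ∀ᶠ δ in 𝓝[>] (0 : ℝ), δ ∈ Ioo (0 : ℝ) 1 := Ioo_mem_nhdsGT one_pos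
    exact (h3.and (h2.filter_mono nhdsWithin_le_nhds)).exists
  have hNo : c.source ∩ interior N ∈ 𝓝 x := inter_mem (c.open_source.mem_nhds hx) (interior_mem_nhds.2 hN)
  have hev : ∀ᶠ u in 𝓝 u₀, ‖φ u - φ u₀‖ ≤ (1 + δ) * ‖A (u - u₀)‖ ∧ (1 - δ) * areaJacobian φ u₀ ≤ areaJacobian φ u ∧
      u ∈ c.target ∧ c.symm u ∈ c.source ∩ interior N := by
    -- The error tolerance `δκ` turns the bound `δκ|u - u₀|` into `δ|A(u - u₀)|`.
    have h1 := (hφ.differentiableAt (by simp)).hasFDerivAt.isLittleO.bound (mul_pos hδ0 hκ)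
    have h2 := (contDiffAt_areaJacobian hφ hi).continuousAt.eventually_const_lt
      (show (1 - δ) * areaJacobian φ u₀ < areaJacobian φ u₀ by nlinarith)
    have h3 : ∀ᶠ u in 𝓝 u₀, c.symm u ∈ c.source ∩ interior N :=
      (c.continuousAt_symm (c.map_source hx)).eventually_mem (by rwa [c.left_inv hx])
    filter_upwards [h1, h2, h3, c.open_target.mem_nhds (c.map_source hx)] with u hu1 hu2 hu3 hu4
    refine ⟨?_, hu2.le, hu4, hu3⟩
    have h4 : ‖φ u - φ u₀‖ ≤ ‖φ u - φ u₀ - A (u - u₀)‖ + ‖A (u - u₀)‖ := by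
      simpa using norm_add_le (φ u - φ u₀ - A (u - u₀)) (A (u - u₀))
    have h5 : δ * (κ * ‖u - u₀‖) ≤ δ * ‖A (u - u₀)‖ := by gcongr; exact hκA _
    linarith
  obtain ⟨η, hη, hball⟩ := Metric.eventually_nhds_iff_ball.1 hev
  -- For `r < κη` the ellipsoid lies in the `η`-ball where the estimates hold.
  filter_upwards [Ioo_mem_nhdsGT (mul_pos hκ hη)] with r hr
  have hr0 : 0 < r := hr.1
  set r' := r * (1 + δ)⁻¹ with hr'
  have hr'0 : 0 < r' := by positivity
  have hr'r : r' ≤ r := mul_le_of_le_one_right hr0.le (inv_le_one_of_one_le₀ (by linarith))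
  set S : Set (𝔼 m) := (fun u => u - u₀) ⁻¹' {w | ‖A w‖ < r'} with hS
  have hSvol : volume S = volume {w | ‖A w‖ < r'} := by
    simp only [hS, sub_eq_add_neg]
    exact measure_preimage_add_right volume (-u₀) _
  have hSball : ∀ u ∈ S, u ∈ Metric.ball u₀ η := by
    intro u hu
    have h1 : ‖A (u - u₀)‖ < r' := hu
    have h2 := hκA (u - u₀)
    rw [mem_ball_iff_norm]
    have h3 : κ * ‖u - u₀‖ < κ * η := by linarith [hr.2]
    exact lt_of_mul_lt_mul_left h3 hκ.le
  set T := F ⁻¹' Metric.ball (F x) r ∩ (c.source ∩ interior N) with hT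
  have hTm : MeasurableSet T := ((Metric.isOpen_ball.preimage hF.continuous).inter
    (c.open_source.inter isOpen_interior)).measurableSet
  have hST : S ⊆ c.target ∩ c.symm ⁻¹' T := by
    intro u hu
    obtain ⟨h1, h2, h3, h4⟩ := hball u (hSball u hu)
    refine ⟨h3, ?_, h4⟩
    have h5 : ‖A (u - u₀)‖ < r' := hu
    have h6 : φ u₀ = F x := localParam_chartAt F hx
    rw [mem_preimage, mem_ball_iff_norm, ← h6]
    calc ‖φ u - φ u₀‖ ≤ (1 + δ) * ‖A (u - u₀)‖ := h1
      _ < (1 + δ) * r' := by gcongr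
      _ = r := by rw [hr']; field_simp
  calc ENNReal.ofReal a * (volume (Metric.ball (0 : 𝔼 m) 1) * ENNReal.ofReal (r ^ m))
      ≤ ENNReal.ofReal ((1 - δ) * ((1 + δ)⁻¹) ^ m) *
          (volume (Metric.ball (0 : 𝔼 m) 1) * ENNReal.ofReal (r ^ m)) := by gcongr
    _ = ENNReal.ofReal (1 - δ) * (volume (Metric.ball (0 : 𝔼 m) 1) * ENNReal.ofReal (r' ^ m)) := by
        rw [hr', mul_pow, ENNReal.ofReal_mul (by linarith), ENNReal.ofReal_mul (by positivity)]
        ring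
    _ = ENNReal.ofReal ((1 - δ) * areaJacobian φ u₀) * volume S := by
        rw [← sqrt_det_gramMatrix_mul_volume hi hr'0, hSvol, ENNReal.ofReal_mul (by linarith), mul_assoc]
        rfl
    _ = ∫⁻ _ in S, ENNReal.ofReal ((1 - δ) * areaJacobian φ u₀) := by rw [setLIntegral_const]
    _ ≤ ∫⁻ u in S, ENNReal.ofReal (areaJacobian φ u) := by
        have hSm : MeasurableSet S := by
          have : IsOpen S := by
            refine IsOpen.preimage (by fun_prop) (isOpen_lt (by fun_prop) continuous_const)
          exact this.measurableSet
        exact setLIntegral_mono' hSm fun u hu => ENNReal.ofReal_le_ofReal (hball u (hSball u hu)).2.1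
    _ ≤ ∫⁻ u in c.target ∩ c.symm ⁻¹' T, ENNReal.ofReal (areaJacobian φ u) := lintegral_mono_set hST
    _ = areaMeasure m F T :=
        (areaMeasure_apply_of_subset_source hF.contMDiff_one hTm fun z hz => hz.2.1).symm
    _ ≤ areaMeasure m F (F ⁻¹' Metric.ball (F x) r ∩ N) :=
        measure_mono fun z hz => ⟨hz.1, interior_subset hz.2.2⟩

/-- Lets a continuous defect that vanishes almost everywhere be concluded to vanish everywhere. -/
theorem isOpenPosMeasure : Measure.IsOpenPosMeasure (areaMeasure m F) := by
  refine ⟨fun U hU hne h0 => ?_⟩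
  obtain ⟨x, hx⟩ := hne
  have hev := ((hF.eventually_le_area x (hU.mem_nhds hx) (a := 1 / 2) (by norm_num)).and
    (self_mem_nhdsWithin : Ioi (0 : ℝ) ∈ 𝓝[>] 0))
  obtain ⟨r, hr, hr0⟩ := hev.exists
  have hr0' : (0 : ℝ) < r := hr0
  have h1 : areaMeasure m F (F ⁻¹' Metric.ball (F x) r ∩ U) = 0 := measure_mono_null inter_subset_right h0
  rw [h1, nonpos_iff_eq_zero] at hr
  have h2 : volume (Metric.ball (0 : 𝔼 m) 1) ≠ 0 := (Metric.measure_ball_pos _ _ one_pos).ne'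
  have h3 : ENNReal.ofReal (r ^ m) ≠ 0 := by simpa using pow_pos hr0' m
  have h4 : ENNReal.ofReal (1 / 2) ≠ 0 := by simp
  exact mul_ne_zero h4 (mul_ne_zero h2 h3) hr

end IsProperMinimalImmersion

end Manifold

/-! ### Density ratios and the density at infinity -/

variable (m) in
theorem volume_unitBall_ne_zero : volume (Metric.ball (0 : 𝔼 m) 1) ≠ 0 :=
  (Metric.measure_ball_pos _ _ one_pos).ne'

variable (m) in
theorem volume_unitBall_ne_top : volume (Metric.ball (0 : 𝔼 m) 1) ≠ ⊤ := measure_ball_lt_top.ne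

theorem volume_unitBall_mul_ne_zero {r : ℝ} (hr : 0 < r) :
    volume (Metric.ball (0 : 𝔼 m) 1) * ENNReal.ofReal (r ^ m) ≠ 0 :=
  mul_ne_zero (volume_unitBall_ne_zero m) (by simpa using pow_pos hr m)

theorem volume_unitBall_mul_ne_top (r : ℝ) :
    volume (Metric.ball (0 : 𝔼 m) 1) * ENNReal.ofReal (r ^ m) ≠ ⊤ :=
  ENNReal.mul_ne_top (volume_unitBall_ne_top m) ENNReal.ofReal_ne_top

theorem volume_ball_eq {r : ℝ} (hr : 0 < r) :
    volume (Metric.ball (0 : 𝔼 m) r) = volume (Metric.ball (0 : 𝔼 m) 1) * ENNReal.ofReal (r ^ m) := by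
  rw [Measure.addHaar_ball_of_pos _ _ hr, mul_comm]
  simp

section Manifold

variable {M : Type*} [TopologicalSpace M] [ChartedSpace (𝔼 m) M] [MeasurableSpace M] {F : M → 𝔼 n}

theorem le_densityRatio_iff {p : 𝔼 n} {r : ℝ} (hr : 0 < r) {a : ℝ≥0∞} : a ≤ densityRatio m F p r ↔
    a * (volume (Metric.ball (0 : 𝔼 m) 1) * ENNReal.ofReal (r ^ m)) ≤ areaMeasure m F (F ⁻¹' Metric.ball p r) :=
  ENNReal.le_div_iff_mul_le (Or.inl (volume_unitBall_mul_ne_zero hr)) (Or.inl (volume_unitBall_mul_ne_top r))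

theorem densityRatio_le_iff {p : 𝔼 n} {r : ℝ} (hr : 0 < r) {a : ℝ≥0∞} : densityRatio m F p r ≤ a ↔
    areaMeasure m F (F ⁻¹' Metric.ball p r) ≤ a * (volume (Metric.ball (0 : 𝔼 m) 1) * ENNReal.ofReal (r ^ m)) :=
  ENNReal.div_le_iff_le_mul (Or.inl (volume_unitBall_mul_ne_zero hr)) (Or.inl (volume_unitBall_mul_ne_top r))

theorem densityRatio_mul {p : 𝔼 n} {r : ℝ} (hr : 0 < r) :
    densityRatio m F p r * (volume (Metric.ball (0 : 𝔼 m) 1) * ENNReal.ofReal (r ^ m)) =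
      areaMeasure m F (F ⁻¹' Metric.ball p r) :=
  ENNReal.div_mul_cancel (volume_unitBall_mul_ne_zero hr) (volume_unitBall_mul_ne_top r)

theorem densityRatio_of_nonpos (p : 𝔼 n) {r : ℝ} (hr : r ≤ 0) : densityRatio m F p r = 0 := by
  simp [densityRatio, Metric.ball_eq_empty.2 hr]

theorem densityRatio_le_mul (p q : 𝔼 n) {r : ℝ} (hr : 0 < r) :
    densityRatio m F p r ≤ densityRatio m F q (r + dist p q) * ENNReal.ofReal ((1 + dist p q / r) ^ m) := by
  have hd : 0 < r + dist p q := by positivity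
  rw [densityRatio_le_iff hr]
  calc areaMeasure m F (F ⁻¹' Metric.ball p r) ≤ areaMeasure m F (F ⁻¹' Metric.ball q (r + dist p q)) :=
        measure_mono (preimage_mono (Metric.ball_subset_ball' le_rfl))
    _ = _ := by
        rw [← densityRatio_mul hd, mul_assoc]
        congr 1
        rw [mul_left_comm, ← ENNReal.ofReal_mul (by positivity), ← mul_pow]
        congr 3
        field_simp

variable [IsManifold (𝓡 m) ∞ M] [BorelSpace M] [SecondCountableTopology M] [Nonempty M]

namespace IsProperMinimalImmersion

variable (hF : IsProperMinimalImmersion m F)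

include hF

theorem area_ball_lt_top (p : 𝔼 n) (r : ℝ) : areaMeasure m F (F ⁻¹' Metric.ball p r) < ⊤ :=
  have := hF.isLocallyFiniteMeasure
  (measure_mono (preimage_mono Metric.ball_subset_closedBall)).trans_lt
    (hF.isCompact_preimage p r).measure_lt_top

theorem densityRatio_mono [T2Space M] (p : 𝔼 n) : Monotone (densityRatio m F p) := by
  intro r s hrs
  rcases le_or_gt r 0 with hr | hr
  · rw [densityRatio_of_nonpos p hr]
    exact zero_le
  have hs := hr.trans_le hrs
  have key : ∀ {t : ℝ}, 0 < t → densityRatio m F p t =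
      ENNReal.ofReal ((areaMeasure m F).real (F ⁻¹' Metric.ball p t) / t ^ m) *
        (volume (Metric.ball (0 : 𝔼 m) 1))⁻¹ := by
    intro t ht
    rw [ENNReal.ofReal_div_of_pos (pow_pos ht m), ofReal_measureReal (hF.area_ball_lt_top p t).ne,
      densityRatio, div_eq_mul_inv, div_eq_mul_inv,
      ENNReal.mul_inv (Or.inl (volume_unitBall_ne_zero m)) (Or.inl (volume_unitBall_ne_top m))]
    ring
  rw [key hr, key hs]
  refine mul_le_mul_left (ENNReal.ofReal_le_ofReal ?_) _
  exact hF.monotoneOn_area_div_pow p hr hs hrs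

/-- Enlarging the ball to change centre costs the factor `(1 + |p - q|/r)ᵐ`, which tends to `1`. -/
theorem iSup_densityRatio_le [T2Space M] (p q : 𝔼 n) :
    ⨆ r, densityRatio m F p r ≤ ⨆ r, densityRatio m F q r := by
  set Θ := ⨆ r, densityRatio m F q r with hΘ
  by_cases htop : Θ = ⊤
  · rw [htop]; exact le_top
  have h1 := tendsto_atTop_iSup (hF.densityRatio_mono p)
  have h2 : Tendsto (fun r : ℝ => Θ * ENNReal.ofReal ((1 + dist p q / r) ^ m)) atTop (𝓝 Θ) := by
    have h3 : Tendsto (fun r : ℝ => (1 + dist p q / r) ^ m) atTop (𝓝 1) := by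
      have := ((tendsto_const_nhds (x := dist p q)).div_atTop tendsto_id).const_add 1 |>.pow m
      simpa using this
    have h4 := ENNReal.Tendsto.const_mul (a := Θ) (ENNReal.tendsto_ofReal h3) (Or.inr htop)
    simpa using h4
  refine le_of_tendsto_of_tendsto h1 h2 ?_
  filter_upwards [eventually_gt_atTop 0] with r hr
  refine (densityRatio_le_mul p q hr).trans ?_
  gcongr
  exact le_iSup (fun r => densityRatio m F q r) _

theorem hasDensityAtInfinity [T2Space M] (q : 𝔼 n) :
    HasDensityAtInfinity m F (⨆ r, densityRatio m F q r) := by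
  intro p
  rw [le_antisymm (hF.iSup_densityRatio_le q p) (hF.iSup_densityRatio_le p q)]
  exact tendsto_atTop_iSup (hF.densityRatio_mono p)

theorem one_le_densityRatio [T2Space M] (x : M) {r : ℝ} (hr : 0 < r) : 1 ≤ densityRatio m F (F x) r := by
  refine le_of_forall_lt_imp_le_of_dense fun a ha => ?_
  have ha' : a ≠ ⊤ := (ha.trans ENNReal.one_lt_top).ne
  have h1 : a.toReal < 1 := by
    rw [← ENNReal.toReal_one]
    exact ENNReal.toReal_strict_mono ENNReal.one_ne_top ha
  have h2 : ∀ᶠ s in 𝓝[>] (0 : ℝ), s ∈ Ioc 0 r := Ioc_mem_nhdsGT hr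
  obtain ⟨s, hs, hs'⟩ := ((hF.eventually_le_area x univ_mem h1).and h2).exists
  rw [ENNReal.ofReal_toReal ha', inter_univ, ← le_densityRatio_iff hs'.1] at hs
  exact hs.trans (hF.densityRatio_mono _ hs'.2)

/-- Two points with the same image have disjoint neighbourhoods, each contributing at least `3/4` of
a flat ball at small radii; the total `3/2` exceeds `1`. -/
theorem injective_of_densityRatio_le_one [T2Space M] (h : ∀ x : M, ∀ r, densityRatio m F (F x) r ≤ 1) :
    Function.Injective F := by
  intro x y hxy
  by_contra hne
  obtain ⟨U, V, hU, hV, hxU, hyV, hd⟩ := t2_separation hne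
  have h1 := hF.eventually_le_area x (hU.mem_nhds hxU) (a := 3 / 4) (by norm_num)
  have h2 := hF.eventually_le_area y (hV.mem_nhds hyV) (a := 3 / 4) (by norm_num)
  rw [← hxy] at h2
  have h3 : ∀ᶠ s in 𝓝[>] (0 : ℝ), 0 < s := self_mem_nhdsWithin
  obtain ⟨r, hr1, hr2, hr⟩ := (h1.and (h2.and h3)).exists
  have h4 := add_le_add hr1 hr2
  rw [← measure_union (hd.mono inter_subset_right inter_subset_right)
    ((Metric.isOpen_ball.preimage hF.continuous).inter hV).measurableSet, ← add_mul,
    ← ENNReal.ofReal_add (by norm_num) (by norm_num)] at h4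
  have h5 := (le_densityRatio_iff hr).2
    (h4.trans (measure_mono (union_subset inter_subset_left inter_subset_left)))
  have h6 := h5.trans (h x r)
  rw [ENNReal.ofReal_le_one] at h6
  norm_num at h6

/-- Under the distance to `p`, and the norm on `ℝᵐ`, the two measures push forward to measures on
the line that agree and are finite on all `Iio r`, hence are equal. -/
theorem integral_comp_norm_sub {p : 𝔼 n}
    (h : ∀ r > 0, areaMeasure m F (F ⁻¹' Metric.ball p r) = volume (Metric.ball (0 : 𝔼 m) r))
    {g : ℝ → ℝ} (hg : Continuous g) :
    ∫ z, g ‖F z - p‖ ∂(areaMeasure m F) = ∫ u : 𝔼 m, g ‖u‖ := by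
  have hc := hF.continuous
  have hm1 : Measurable fun z => ‖F z - p‖ := (by fun_prop : Continuous fun z => ‖F z - p‖).measurable
  have hm2 : Measurable fun u : 𝔼 m => ‖u‖ := measurable_norm
  have hs1 : ∀ r, (fun z => ‖F z - p‖) ⁻¹' Iio r = F ⁻¹' Metric.ball p r := fun r => by
    ext z; simp [dist_eq_norm]
  have hs2 : ∀ r, (fun u : 𝔼 m => ‖u‖) ⁻¹' Iio r = Metric.ball 0 r := fun r => by
    ext z; simp
  have hIio : ∀ r, (areaMeasure m F).map (fun z => ‖F z - p‖) (Iio r) =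
      (volume : Measure (𝔼 m)).map (fun u => ‖u‖) (Iio r) := by
    intro r
    rw [Measure.map_apply hm1 measurableSet_Iio, Measure.map_apply hm2 measurableSet_Iio, hs1, hs2]
    rcases le_or_gt r 0 with hr | hr
    · simp [Metric.ball_eq_empty.2 hr]
    · exact h r hr
  have hfin : ∀ r, (areaMeasure m F).map (fun z => ‖F z - p‖) (Iio r) ≠ ⊤ := by
    intro r
    rw [Measure.map_apply hm1 measurableSet_Iio, hs1]
    exact (hF.area_ball_lt_top p r).ne
  have hmap : (areaMeasure m F).map (fun z => ‖F z - p‖) = (volume : Measure (𝔼 m)).map fun u => ‖u‖ := by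
    refine Measure.ext_of_Ico' _ _ (fun a b _ => ?_) fun a b hab => ?_
    · exact measure_ne_top_of_subset Ico_subset_Iio_self (hfin b)
    · have hdiff : Ico a b = Iio b \ Iio a := by ext; simp
      rw [hdiff, measure_sdiff (Iio_subset_Iio hab.le) measurableSet_Iio.nullMeasurableSet (hfin a),
        measure_sdiff (Iio_subset_Iio hab.le) measurableSet_Iio.nullMeasurableSet (hIio a ▸ hfin a),
        hIio, hIio]
  rw [← integral_map hm1.aemeasurable hg.aestronglyMeasurable (f := g), hmap,
    integral_map hm2.aemeasurable hg.aestronglyMeasurable]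

/-- The equality case of monotonicity: `sᵐ ∫ χ(s²|F - p|²)` takes its flat value, which scaling
shows to be independent of `s`. Its derivative is zero, so the nonnegative continuous defect
vanishes identically. -/
theorem tangentialPart_eq_of_densityRatio_eq_one [T2Space M] {p : 𝔼 n}
    (h : ∀ r > 0, densityRatio m F p r = 1) (z : M) : tangentialPart m F p z = ‖F z - p‖ ^ 2 := by
  have hball : ∀ r > 0, areaMeasure m F (F ⁻¹' Metric.ball p r) = volume (Metric.ball (0 : 𝔼 m) r) :=
    fun r hr => by rw [← densityRatio_mul hr, h r hr, one_mul, volume_ball_eq hr]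
  -- The profile with `k = 1` is `(1 - s)₊²`, whose derivative is nonzero for all `s < 1`.
  have hχ := isProfile_approxProfile 1
  have hχc := hχ.contDiff.continuous
  have hconst : ∀ s > 0, s ^ m * ∫ z, approxProfile 1 (s ^ 2 * ‖F z - p‖ ^ 2) ∂(areaMeasure m F) =
      ∫ u : 𝔼 m, approxProfile 1 (‖u‖ ^ 2) := by
    intro s hs
    rw [hF.integral_comp_norm_sub hball (g := fun r => approxProfile 1 (s ^ 2 * r ^ 2)) (by fun_prop)]
    have h1 := Measure.integral_comp_smul (volume : Measure (𝔼 m)) (fun u => approxProfile 1 (‖u‖ ^ 2)) s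
    simp only [norm_smul, mul_pow, Real.norm_eq_abs, sq_abs, finrank_euclideanSpace, Fintype.card_fin] at h1
    rw [h1, abs_of_pos (by positivity), smul_eq_mul, mul_inv_cancel_left₀ (by positivity)]
  -- A scale at which the given `z` lies where the derivative of the profile is nonzero.
  obtain ⟨t, ht, htz⟩ : ∃ t > 0, t ^ 2 * ‖F z - p‖ ^ 2 < 1 := by
    refine ⟨(‖F z - p‖ + 1)⁻¹, by positivity, ?_⟩
    rw [← mul_pow, sq_lt_one_iff₀ (by positivity), inv_mul_lt_iff₀ (by positivity)]
    linarith
  have hzero : ∫ z, 2 * t ^ 2 * deriv (approxProfile 1) (t ^ 2 * ‖F z - p‖ ^ 2) *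
      (tangentialPart m F p z - ‖F z - p‖ ^ 2) ∂(areaMeasure m F) = 0 := by
    have h1 := hF.hasDerivAt_pow_mul_integral_profile p hχ ht
    have h2 : (fun s : ℝ => s ^ m * ∫ z, approxProfile 1 (s ^ 2 * ‖F z - p‖ ^ 2) ∂(areaMeasure m F)) =ᶠ[𝓝 t]
        fun _ => ∫ u : 𝔼 m, approxProfile 1 (‖u‖ ^ 2) := by
      filter_upwards [lt_mem_nhds ht] with s hs using hconst s hs
    have h3 := h1.unique ((hasDerivAt_const t _).congr_of_eventuallyEq h2)
    have h4 : t ^ m / t ≠ 0 := by positivity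
    simpa [h4] using h3
  have hcont := hF.continuous_radial_defect p hχ (t := t)
  have := hF.isOpenPosMeasure
  rw [integral_eq_zero_iff_of_nonneg (fun z => hF.radial_defect_nonneg p hχ z)
    (hF.integrable_of_eq_zero p hcont ht fun z hz => by rw [hχ.deriv_eq_zero hz]; ring),
    hcont.ae_eq_iff_eq _ continuous_zero] at hzero
  have hz := congrFun hzero z
  have hd : deriv (approxProfile 1) (t ^ 2 * ‖F z - p‖ ^ 2) ≠ 0 := by
    rw [(hasDerivAt_approxProfile 1 _).deriv, max_eq_left (by linarith)]
    simp only [Nat.cast_one, Nat.sub_self, pow_zero]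
    intro h0
    linarith
  rcases mul_eq_zero.1 hz with h1 | h1
  · exact absurd h1 (mul_ne_zero (by positivity) hd)
  · exact sub_eq_zero.1 h1

end IsProperMinimalImmersion

end Manifold

/-! ### Immersions into an `m`-plane -/

theorem adjoint_isometry_apply (J : 𝔼 m →ₗᵢ[ℝ] 𝔼 n) (v : 𝔼 m) :
    J.toContinuousLinearMap.adjoint (J v) = v :=
  ext_inner_left ℝ fun w => by
    rw [ContinuousLinearMap.adjoint_inner_right]
    exact J.inner_map_map w v

/-- The coordinates of `F` in the plane through `q` spanned by the range of the isometry `J`. -/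
noncomputable def planeCoord {M : Type*} (J : 𝔼 m →ₗᵢ[ℝ] 𝔼 n) (q : 𝔼 n) (F : M → 𝔼 n) (z : M) : 𝔼 m :=
  J.toContinuousLinearMap.adjoint (F z - q)

theorem isometry_planeCoord {M : Type*} {J : 𝔼 m →ₗᵢ[ℝ] 𝔼 n} {q : 𝔼 n} {F : M → 𝔼 n} {z : M}
    (h : F z - q ∈ range J) : J (planeCoord J q F z) = F z - q := by
  obtain ⟨v, hv⟩ := h
  rw [planeCoord, ← hv, adjoint_isometry_apply]

section Manifold

variable {M : Type*} [TopologicalSpace M] [ChartedSpace (𝔼 m) M] [IsManifold (𝓡 m) ∞ M] {F : M → 𝔼 n}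

namespace IsProperMinimalImmersion

variable (hF : IsProperMinimalImmersion m F) {J : 𝔼 m →ₗᵢ[ℝ] 𝔼 n} {q : 𝔼 n}
  (hJ : ∀ z, F z - q ∈ range J)

include hF

theorem contMDiff_planeCoord (J : 𝔼 m →ₗᵢ[ℝ] 𝔼 n) (q : 𝔼 n) :
    ContMDiff (𝓡 m) (𝓡 m) ∞ (planeCoord J q F) := by
  have h : ContDiff ℝ ∞ fun y : 𝔼 n => J.toContinuousLinearMap.adjoint (y - q) :=
    J.toContinuousLinearMap.adjoint.contDiff.comp (contDiff_id.sub contDiff_const)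
  exact h.contMDiff.comp hF.contMDiff

include hJ

theorem fderiv_localParam_eq_comp {x z : M} (hz : z ∈ (chartAt (𝔼 m) x).source) :
    fderiv ℝ (localParam F x) (chartAt (𝔼 m) x z) =
      J.toContinuousLinearMap.comp (fderiv ℝ (localParam (planeCoord J q F) x) (chartAt (𝔼 m) x z)) := by
  have h1 : localParam (m := m) F x = fun u => J.toContinuousLinearMap (localParam (planeCoord J q F) x u) + q := by
    ext1 u
    exact (sub_eq_iff_eq_add.1 (isometry_planeCoord (hJ _)).symm)
  have h2 := (contDiffAt_localParam le_rfl (hF.contMDiff_planeCoord J q) hz).differentiableAt (by simp)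
  have h3 := (J.toContinuousLinearMap.hasFDerivAt.comp _ h2.hasFDerivAt).add_const q
  rw [h1]
  exact h3.fderiv

theorem det_fderiv_planeCoord_ne_zero {x z : M} (hz : z ∈ (chartAt (𝔼 m) x).source) :
    (fderiv ℝ (localParam (planeCoord J q F) x) (chartAt (𝔼 m) x z)).det ≠ 0 := by
  have h1 := areaJacobian_pos (hF.injective_fderiv hz)
  rw [areaJacobian_eq, hF.fderiv_localParam_eq_comp hJ hz, sqrt_det_gramMatrix_isometry_comp] at h1
  exact abs_pos.1 h1

/-- The image is open by the inverse function theorem and closed because a proper map is closed;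
`ℝᵐ` is connected. Connectedness of `M` plays no role. -/
theorem surjective_planeCoord [Nonempty M] : Function.Surjective (planeCoord J q F) := by
  have hopen : IsOpen (range (planeCoord J q F)) := by
    rw [isOpen_iff_mem_nhds]
    rintro _ ⟨z, rfl⟩
    have hz := mem_chart_source (𝔼 m) z
    have h1 := (contDiffAt_localParam le_rfl (hF.contMDiff_planeCoord J q) hz).hasStrictFDerivAt (by simp)
    have h2 := h1.map_nhds_eq_of_surj (LinearMap.range_eq_top.2
      (surjective_of_det_ne_zero (hF.det_fderiv_planeCoord_ne_zero hJ hz)))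
    rw [localParam_chartAt _ hz] at h2
    rw [← h2]
    refine mem_map.2 (Eventually.of_forall fun u => ?_)
    exact ⟨_, rfl⟩
  have hclosed : IsClosed (range (planeCoord J q F)) := by
    have h1 : range (planeCoord J q F) = (fun v => J v + q) ⁻¹' range F := by
      ext v
      constructor
      · rintro ⟨z, rfl⟩
        exact ⟨z, by simp only [isometry_planeCoord (hJ z), sub_add_cancel]⟩
      · rintro ⟨z, hz⟩
        refine ⟨z, ?_⟩
        rw [planeCoord, hz, add_sub_cancel_right, adjoint_isometry_apply]
    rw [h1]
    exact hF.proper.isClosedMap.isClosed_range.preimage (by fun_prop)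
  exact range_eq_univ.1 (IsClopen.eq_univ ⟨hclosed, hopen⟩ (range_nonempty _))

variable [MeasurableSpace M] [BorelSpace M] [SecondCountableTopology M] [Nonempty M]

/-- In plane coordinates the area Jacobian is `|det|`, so each piece has area equal to the volume of
its image. By injectivity these images are disjoint, and they all lie in the flat ball of radius
`r`. -/
theorem densityRatio_le_one_of_injective (hinj : Function.Injective F) {r : ℝ} (hr : 0 < r) :
    densityRatio m F q r ≤ 1 := by
  rw [densityRatio_le_iff hr, one_mul, ← volume_ball_eq hr]
  obtain ⟨x, A, hAm, hAs, hAd, -, h⟩ := exists_areaMeasure_eq_sum hF.contMDiff_one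
  set ψ := planeCoord J q F with hψ
  have hψinj : Function.Injective ψ := fun y z hyz => hinj <| by
    have h1 := isometry_planeCoord (hJ y)
    rw [← hψ, hyz, isometry_planeCoord (hJ z)] at h1
    exact (sub_left_injective h1).symm
  set B := F ⁻¹' Metric.ball q r with hB
  have hBm : MeasurableSet B := (Metric.isOpen_ball.preimage hF.continuous).measurableSet
  let S : ℕ → Set (𝔼 m) := fun i => (chartAt (𝔼 m) (x i)).target ∩ (chartAt (𝔼 m) (x i)).symm ⁻¹' (B ∩ A i)
  have hS : ∀ i, ∀ u ∈ S i, ∃ z ∈ (chartAt (𝔼 m) (x i)).source, chartAt (𝔼 m) (x i) z = u :=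
    fun i u hu => ⟨_, (chartAt (𝔼 m) (x i)).map_target hu.1, (chartAt (𝔼 m) (x i)).right_inv hu.1⟩
  have hSm : ∀ i, MeasurableSet (S i) := fun i =>
    measurableSet_inter_preimage_of_continuousOn (chartAt (𝔼 m) (x i)).continuousOn_symm
      (chartAt (𝔼 m) (x i)).open_target.measurableSet (hBm.inter (hAm i))
  have hderiv : ∀ i, ∀ u ∈ S i, HasFDerivWithinAt (localParam ψ (x i))
      (fderiv ℝ (localParam ψ (x i)) u) (S i) u := by
    intro i u hu
    obtain ⟨z, hz, rfl⟩ := hS i u hu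
    exact ((contDiffAt_localParam le_rfl (hF.contMDiff_planeCoord J q) hz).differentiableAt
      (by simp)).hasFDerivAt.hasFDerivWithinAt
  have hSinj : ∀ i, InjOn (localParam ψ (x i)) (S i) := fun i u hu v hv huv =>
    (chartAt (𝔼 m) (x i)).symm.injOn hu.1 hv.1 (hψinj huv)
  have hpiece : ∀ i, (chartArea (m := m) F (x i)).restrict (A i) B = volume (localParam ψ (x i) '' S i) := by
    intro i
    rw [Measure.restrict_apply hBm, chartArea_apply F (x i) (hBm.inter (hAm i)), ← setLIntegral_one,
      lintegral_image_eq_lintegral_abs_det_fderiv_mul volume (hSm i) (hderiv i) (hSinj i)]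
    refine setLIntegral_congr_fun (hSm i) fun u hu => ?_
    obtain ⟨z, hz, rfl⟩ := hS i u hu
    rw [mul_one, areaJacobian_eq, hF.fderiv_localParam_eq_comp hJ hz, sqrt_det_gramMatrix_isometry_comp]
  rw [h, Measure.sum_apply _ hBm]
  simp only [hpiece]
  rw [← measure_iUnion]
  · refine measure_mono (iUnion_subset fun i => ?_)
    rintro _ ⟨u, hu, rfl⟩
    rw [mem_ball_zero_iff, ← J.norm_map]
    change ‖J (ψ _)‖ < r
    rw [isometry_planeCoord (hJ _), ← mem_ball_iff_norm]
    exact hu.2.1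
  · intro i j hij
    rw [Function.onFun, disjoint_left]
    rintro _ ⟨u, hu, rfl⟩ ⟨v, hv, huv⟩
    have h1 : (chartAt (𝔼 m) (x j)).symm v = (chartAt (𝔼 m) (x i)).symm u := hψinj huv
    exact disjoint_left.1 (hAd hij) hu.2.2 (h1 ▸ hv.2.2)
  · exact fun i => measurable_image_of_fderivWithin (hSm i) (hderiv i) (hSinj i)

end IsProperMinimalImmersion

/-! ### The equality case -/

namespace IsProperMinimalImmersion

variable [MeasurableSpace M] [BorelSpace M] [SecondCountableTopology M] [Nonempty M] [T2Space M]
  (hF : IsProperMinimalImmersion m F)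

include hF

theorem isMultiplicityOnePlane_of_densityRatio_le_one (h : ∀ p r, densityRatio m F p r ≤ 1) :
    IsMultiplicityOnePlane m F := by
  have hone : ∀ x : M, ∀ r > 0, densityRatio m F (F x) r = 1 := fun x r hr =>
    le_antisymm (h _ _) (hF.one_le_densityRatio x hr)
  obtain ⟨x⟩ := ‹Nonempty M›
  have hx := mem_chart_source (𝔼 m) x
  have hi := hF.injective_fderiv hx
  set A := fderiv ℝ (localParam F x) (chartAt (𝔼 m) x x) with hA
  obtain ⟨J, B, hJB⟩ := exists_isometry_comp hi
  have hJ : ∀ z, F z - F x ∈ range J := by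
    intro z
    -- The centre `F z` varies while the tangent plane is the fixed one at `x`, so a single plane
    -- contains the whole image.
    obtain ⟨v, hv⟩ := mem_range_of_tangentialSq_eq hi
      (hF.tangentialPart_eq_of_densityRatio_eq_one (hone z) x)
    refine ⟨-B v, ?_⟩
    have h1 : J (B v) = F x - F z := by
      rw [← hv, hJB]; rfl
    rw [map_neg, h1, neg_sub]
  refine ⟨AffineSubspace.mk' (F x) J.toLinearMap.range, AffineSubspace.mk'_nonempty _ _, ?_, ?_, ?_, ?_⟩
  · rw [AffineSubspace.direction_mk', LinearMap.finrank_range_of_inj J.injective]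
    simp
  · intro z _
    obtain ⟨v, hv⟩ := hJ z
    exact AffineSubspace.mem_mk'.2 ⟨v, hv⟩
  · exact (hF.injective_of_densityRatio_le_one fun x r => h _ _).injOn
  · intro y hy
    obtain ⟨v, hv⟩ := AffineSubspace.mem_mk'.1 hy
    obtain ⟨z, hz⟩ := hF.surjective_planeCoord hJ v
    refine ⟨z, mem_univ z, ?_⟩
    have h1 := isometry_planeCoord (hJ z)
    rw [hz] at h1
    have h2 : J v = y - F x := hv
    exact sub_left_injective (h1.symm.trans h2)

theorem iSup_densityRatio_le_one_of_isMultiplicityOnePlane (h : IsMultiplicityOnePlane m F) (p : 𝔼 n) :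
    ⨆ r, densityRatio m F p r ≤ 1 := by
  obtain ⟨P, ⟨q, hq⟩, hdim, hbij⟩ := h
  let ι := (stdOrthonormalBasis ℝ P.direction).reindex (finCongr hdim) |>.repr
  let J : 𝔼 m →ₗᵢ[ℝ] 𝔼 n := P.direction.subtypeₗᵢ.comp ι.symm.toLinearIsometry
  have hJ : ∀ z, F z - q ∈ range J := fun z => by
    have hz : F z - q ∈ P.direction := AffineSubspace.vsub_mem_direction (hbij.mapsTo (mem_univ z)) hq
    refine ⟨ι ⟨_, hz⟩, ?_⟩
    change ((ι.symm (ι ⟨_, hz⟩) : P.direction) : 𝔼 n) = _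
    rw [LinearIsometryEquiv.symm_apply_apply]
  -- The supremum is moved to a centre `q` on the plane, where the area comparison applies.
  refine (hF.iSup_densityRatio_le p q).trans (iSup_le fun r => ?_)
  rcases le_or_gt r 0 with hr | hr
  · rw [densityRatio_of_nonpos q hr]; exact zero_le
  · exact hF.densityRatio_le_one_of_injective hJ (injOn_univ.1 hbij.injOn) hr

end IsProperMinimalImmersion

end Manifold

end MinimalImmersion

theorem mainTheorem12 {m n : ℕ} {M : Type*} [TopologicalSpace M] [T2Space M]
    [SecondCountableTopology M] [Nonempty M] [ChartedSpace (EuclideanSpace ℝ (Fin m)) M]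
    [IsManifold (𝓡 m) ∞ M] [MeasurableSpace M] [BorelSpace M]
    (F : M → EuclideanSpace ℝ (Fin n))
    (hF : MinimalImmersion.IsProperMinimalImmersion m F) :
    ∃ Θ : ℝ≥0∞, MinimalImmersion.HasDensityAtInfinity m F Θ ∧ 1 ≤ Θ ∧
      (Θ = 1 ↔ MinimalImmersion.IsMultiplicityOnePlane m F) := by
  obtain ⟨x⟩ := ‹Nonempty M›
  have hle : 1 ≤ ⨆ r, MinimalImmersion.densityRatio m F (F x) r :=
    (hF.one_le_densityRatio x one_pos).trans
      (le_iSup (fun r => MinimalImmersion.densityRatio m F (F x) r) 1)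
  refine ⟨_, hF.hasDensityAtInfinity (F x), hle, fun h => ?_, fun h => ?_⟩
  · refine hF.isMultiplicityOnePlane_of_densityRatio_le_one fun p r => ?_
    rw [← h]
    exact (le_iSup (fun r => MinimalImmersion.densityRatio m F p r) r).trans
      (hF.iSup_densityRatio_le p (F x))
  · exact le_antisymm (hF.iSup_densityRatio_le_one_of_isMultiplicityOnePlane h (F x)) hle
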